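/- Let $X_1,\dots,X_N$ be independent standard Gaussian random variables on a probability space $(\Omega,\mathcal F,\mathbb P)$. For $h\in\mathbb R^N$ put $W(h)=\sum_{i=1}^N h_iX_i$, and let $H_n$ denote the monic (probabilists') Hermite polynomial of degree $n$. The homogeneous Wiener chaos $\mathcal H_0\subset L^2(\Omega,\mathcal F,\mathbb P)$ is the space of constants, and for $n\ge1$, $\mathcal H_n$ is the linear subspace of $L^2(\Omega,\mathcal F,\mathbb P)$ spanned by $\{H_n(W(h)) : h\in\mathbb R^N,\ \|h\|=1\}$. Let $P_n$ be the orthogonal projection of $L^2(\Omega,\mathcal F,\mathbb P)$ onto $\mathcal H_n$, and for $t>0$ let $$T_tF=\sum_{n=0}^\infty e^{-nt}P_nF\qquad (F\in L^2(\Omega,\mathcal F,\mathbb P)),$$ where the series converges in $L^2$. (When $\mathcal F$ is generated by $X_1,\dots,X_N$, so that all random variables have the form $f(X_1,\dots,X_N)$, this is the Ornstein--Uhlenbeck semigroup on $L^2(\Omega,\mathcal F,\mathbb P)$.) Theorem (hypercontractivity of the Ornstein--Uhlenbeck semigroup; Nelson). Let $p>1$, $t>0$ (with $p,t$ real) and $$q(t)=e^{2t}(p-1)+1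 .$$ Then $q(t)>p$. There is exactly one bounded linear operator on the real Banach space $L^p(\Omega,\mathcal F,\mathbb P)$ that agrees with $T_t$ on $L^p\cap L^2$; denote it again by $T_t$. For every $F\in L^p(\Omega,\mathcal F,\mathbb P)$ one has $T_tF\in L^{q(t)}(\Omega,\mathcal F,\mathbb P)$ and $$\|T_tF\|_{q(t)}\le\|F\|_p ,$$ where $\|F\|_r=\mathbb E[|F|^r]^{1/r}$. -/

import Mathlib

open MeasureTheory ProbabilityTheory
open scoped ENNReal

noncomputable section

/-- The random variable `W(h) = ∑ i, h i * X i`, for `h ∈ ℝ^N` (with its Euclidean norm). -/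
def gaussianSum {Ω : Type*} {N : ℕ} (X : Fin N → Ω → ℝ) (h : EuclideanSpace ℝ (Fin N)) :
    Ω → ℝ :=
  fun ω => ∑ i, h i * X i ω

/-- The generators of the homogeneous Wiener chaos of order `n`: the constants for `n = 0`, and
the variables `H_n(W(h))` with `‖h‖ = 1` for `n ≥ 1`, where `H_n` is the monic (probabilists')
Hermite polynomial. -/
def chaosGenerators {Ω : Type*} [MeasurableSpace Ω] (P : Measure Ω) {N : ℕ}
    (X : Fin N → Ω → ℝ) : ℕ → Set (Lp ℝ 2 P)
  | 0 => {F | ∃ c : ℝ, F =ᵐ[P] fun _ => c}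
  | n + 1 => {F | ∃ h : EuclideanSpace ℝ (Fin N), ‖h‖ = 1 ∧
      F =ᵐ[P] fun ω => Polynomial.aeval (gaussianSum X h ω) (Polynomial.hermite (n + 1))}

/-- The homogeneous Wiener chaos of order `n`: the closed linear span in `L²(P)` of its
generators. (For `N < ∞` Gaussian variables the span is finite-dimensional, hence already
closed; the closure only serves to make the orthogonal projection available.) -/
def wienerChaos {Ω : Type*} [MeasurableSpace Ω] (P : Measure Ω) {N : ℕ}
    (X : Fin N → Ω → ℝ) (n : ℕ) : Submodule ℝ (Lp ℝ 2 P) :=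
  (Submodule.span ℝ (chaosGenerators P X n)).topologicalClosure

instance instHasOrthogonalProjectionWienerChaos {Ω : Type*} [MeasurableSpace Ω] (P : Measure Ω)
    {N : ℕ} (X : Fin N → Ω → ℝ) (n : ℕ) : (wienerChaos P X n).HasOrthogonalProjection := by
  unfold wienerChaos
  infer_instance

/-- `P_n`, the orthogonal projection of `L²(P)` onto the Wiener chaos of order `n`. -/
def chaosProj {Ω : Type*} [MeasurableSpace Ω] (P : Measure Ω) {N : ℕ}
    (X : Fin N → Ω → ℝ) (n : ℕ) : Lp ℝ 2 P →L[ℝ] Lp ℝ 2 P :=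
  (wienerChaos P X n).starProjection

/-- The Ornstein–Uhlenbeck semigroup on `L²`: `T_t F = ∑ n, e^{-nt} P_n F`, the series
converging in `L²(P)`. -/
def ouSemigroup {Ω : Type*} [MeasurableSpace Ω] (P : Measure Ω) {N : ℕ}
    (X : Fin N → Ω → ℝ) (t : ℝ) (F : Lp ℝ 2 P) : Lp ℝ 2 P :=
  ∑' n : ℕ, Real.exp (-(n * t)) • chaosProj P X n F

/-- The series defining `T_t F` converges in `L²(P)` for every `t > 0`. -/
theorem hasSum_ouSemigroup {Ω : Type*} [MeasurableSpace Ω] (P : Measure Ω) {N : ℕ}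
    (X : Fin N → Ω → ℝ) {t : ℝ} (ht : 0 < t) (F : Lp ℝ 2 P) :
    HasSum (fun n : ℕ => Real.exp (-(n * t)) • chaosProj P X n F) (ouSemigroup P X t F) := by
  have hs : Summable fun n : ℕ => Real.exp (-t) ^ n * ‖F‖ :=
    (summable_geometric_of_lt_one (Real.exp_pos _).le
      (Real.exp_lt_one_iff.mpr (by linarith))).mul_right _
  refine (Summable.of_norm_bounded hs fun n => ?_).hasSum
  rw [norm_smul, Real.norm_of_nonneg (Real.exp_pos _).le, ← Real.exp_nat_mul,
    show -((n : ℝ) * t) = n * -t by ring]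
  exact mul_le_mul_of_nonneg_left ((wienerChaos P X n).norm_starProjection_apply_le F)
    (Real.exp_pos _).le

/-- `T` acts on `L^r(P)` as `T_t`: it agrees with `T_t F = ∑ n, e^{-nt} P_n F` on
`L^r(P) ∩ L²(P)`. -/
def ExtendsOU {Ω : Type*} [MeasurableSpace Ω] (P : Measure Ω) {N : ℕ}
    (X : Fin N → Ω → ℝ) (t : ℝ) {r : ℝ≥0∞} (T : Lp ℝ r P → Lp ℝ r P) : Prop :=
  ∀ (F : Lp ℝ r P) (G : Lp ℝ 2 P), F =ᵐ[P] G → T F =ᵐ[P] ouSemigroup P X t G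

end

section HermiteMehler

/-- Any polynomial in a standard Gaussian variable belongs to every `L^r`, `r < ∞`. -/
theorem memLp_eval_gaussianReal (p : Polynomial ℝ) {r : ℝ≥0∞} (hr : r ≠ ∞) :
    MemLp (fun x => p.eval x) r (gaussianReal 0 1) := by
  induction p using Polynomial.induction_on' with
  | add p q hp hq => 
    simp only [Polynomial.eval_add]
    exact hp.add hq
  | monomial n a =>
    simp only [Polynomial.eval_monomial]
    refine MemLp.const_mul ?_ a
    rcases Nat.eq_zero_or_pos n with rfl | hn
    · simpa using memLp_const (1 : ℝ)
    have h := (memLp_id_gaussianReal' (μ := 0) (v := 1) (n * r)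
      (ENNReal.mul_ne_top (by simp) hr)).norm_rpow_div (q := n)
    rw [mul_comm, ENNReal.mul_div_cancel_right (by simpa using hn.ne') (by simp)] at h
    refine (memLp_norm_iff (by fun_prop)).1 (h.congr_norm (by fun_prop) ?_)
    filter_upwards with x
    simp

theorem integrable_eval_gaussianReal (p : Polynomial ℝ) :
    Integrable (fun x => p.eval x) (gaussianReal 0 1) :=
  memLp_one_iff_integrable.1 (memLp_eval_gaussianReal p (by simp))

/-- Gaussian integration by parts for polynomials. -/
theorem integral_mul_eval_gaussianReal (p : Polynomial ℝ) :
    ∫ x, x * p.eval x ∂gaussianReal 0 1 = ∫ x, p.derivative.eval x ∂gaussianReal 0 1 := by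
  have key : ∀ q : Polynomial ℝ, Integrable (fun x => q.eval x * gaussianPDFReal 0 1 x) := by
    intro q
    have := integrable_eval_gaussianReal q
    rw [gaussianReal_of_var_ne_zero _ one_ne_zero,
      integrable_withDensity_iff (measurable_gaussianPDF _ _)
        (.of_forall fun _ => gaussianPDF_lt_top)] at this
    simpa [toReal_gaussianPDF] using this
  have hd : ∀ x, HasDerivAt (gaussianPDFReal 0 1) (-x * gaussianPDFReal 0 1 x) x := by
    intro x
    have h : HasDerivAt (fun y : ℝ => -(y - 0) ^ 2 / (2 * ((1 : NNReal) : ℝ))) (-x) x := by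
      have := ((hasDerivAt_pow 2 x).neg).div_const 2
      convert! this using 1
      · ext y; norm_num
      · norm_num; ring
    have := (h.exp).const_mul (√(2 * Real.pi * ((1 : NNReal) : ℝ)))⁻¹
    convert! this using 1
    simp only [gaussianPDFReal]
    ring
  rw [integral_gaussianReal_eq_integral_smul one_ne_zero,
    integral_gaussianReal_eq_integral_smul one_ne_zero]
  have := integral_mul_deriv_eq_deriv_mul_of_integrable (u := fun x => p.eval x)
    (u' := fun x => p.derivative.eval x) (v := gaussianPDFReal 0 1)
    (v' := fun x => -x * gaussianPDFReal 0 1 x) (fun x _ => p.hasDerivAt x) (fun x _ => hd x)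
    (by
      refine (key (p * Polynomial.X)).neg.congr (.of_forall fun x => ?_)
      simp only [Pi.mul_apply, Pi.neg_apply, Polynomial.eval_mul, Polynomial.eval_X]
      ring)
    (key _) (key _)
  simp only [smul_eq_mul]
  calc ∫ x, gaussianPDFReal 0 1 x * (x * p.eval x)
      = - ∫ x, p.eval x * (-x * gaussianPDFReal 0 1 x) := by
        rw [← integral_neg]; congr 1; ext x; ring
    _ = ∫ x, p.derivative.eval x * gaussianPDFReal 0 1 x := by rw [this, neg_neg]
    _ = _ := by congr 1; ext x; ring

theorem derivative_hermite_succ (n : ℕ) :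
    Polynomial.derivative (Polynomial.hermite (n + 1)) = (n + 1 : ℤ) • Polynomial.hermite n := by
  induction n with
  | zero => simp
  | succ n ih =>
    rw [Polynomial.hermite_succ (n + 1), Polynomial.derivative_sub, Polynomial.derivative_mul,
      Polynomial.derivative_X, ih, Polynomial.derivative_smul, Polynomial.hermite_succ n]
    simp only [zsmul_eq_mul]
    push_cast
    ring

theorem aeval_hermite_succ_succ (n : ℕ) (x : ℝ) :
    Polynomial.aeval x (Polynomial.hermite (n + 2)) =
      x * Polynomial.aeval x (Polynomial.hermite (n + 1))
        - (n + 1) * Polynomial.aeval x (Polynomial.hermite n) := by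
  rw [Polynomial.hermite_succ (n + 1), derivative_hermite_succ]
  simp

/-- The Mehler formula in dimension one: Hermite polynomials are eigenfunctions. -/
theorem integral_aeval_hermite_gaussianReal (n : ℕ) (r c : ℝ) (hrc : r ^ 2 + c ^ 2 = 1) (a : ℝ) :
    ∫ z, Polynomial.aeval (r * a + c * z) (Polynomial.hermite n) ∂gaussianReal 0 1
      = r ^ n * Polynomial.aeval a (Polynomial.hermite n) := by
  induction n using Nat.strong_induction_on with
  | _ n ih =>
  match n with
  | 0 => simp
  | 1 =>
    simp only [Polynomial.hermite_one, Polynomial.aeval_X, pow_one]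
    have hid : Integrable (fun z : ℝ => z) (gaussianReal 0 1) := IsGaussian.integrable_id
    rw [integral_add (integrable_const _) (hid.const_mul c),
      show ∫ z, c * z ∂gaussianReal 0 1 = c * ∫ z, z ∂gaussianReal 0 1 from integral_const_mul c _]
    simp
  | n + 2 =>
    set q : Polynomial ℝ := Polynomial.C (r * a) + Polynomial.C c * Polynomial.X with hq
    have hcomp : ∀ (P : Polynomial ℤ) (z : ℝ), Polynomial.aeval (r * a + c * z) P
        = ((P.map (Int.castRingHom ℝ)).comp q).eval z := by
      intro P z
      simp [hq, Polynomial.aeval_def, Polynomial.eval₂_eq_eval_map]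
    have hint : ∀ P : Polynomial ℤ, Integrable (fun z => Polynomial.aeval (r * a + c * z) P)
        (gaussianReal 0 1) := by
      intro P
      simp only [hcomp]
      exact integrable_eval_gaussianReal _
    have hstein : ∫ z, z * Polynomial.aeval (r * a + c * z) (Polynomial.hermite (n + 1))
        ∂gaussianReal 0 1 = c * ((n + 1) * (r ^ n * Polynomial.aeval a (Polynomial.hermite n))) := by
      simp only [hcomp]
      rw [integral_mul_eval_gaussianReal, ← ih n (by omega), ← integral_const_mul,
        ← integral_const_mul]
      congr 1
      ext z
      rw [hcomp, Polynomial.derivative_comp, Polynomial.derivative_map, derivative_hermite_succ]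
      simp [hq]
    have hint2 : Integrable (fun z => z * Polynomial.aeval (r * a + c * z)
        (Polynomial.hermite (n + 1))) (gaussianReal 0 1) := by
      simp only [hcomp]
      refine (integrable_eval_gaussianReal
        (Polynomial.X * ((Polynomial.hermite (n + 1)).map (Int.castRingHom ℝ)).comp q)).congr
        (.of_forall fun z => ?_)
      simp only [Polynomial.eval_mul, Polynomial.eval_X]
    calc ∫ z, Polynomial.aeval (r * a + c * z) (Polynomial.hermite (n + 2)) ∂gaussianReal 0 1
        = ∫ z, (r * a) * Polynomial.aeval (r * a + c * z) (Polynomial.hermite (n + 1))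
          + c * (z * Polynomial.aeval (r * a + c * z) (Polynomial.hermite (n + 1)))
          - (n + 1) * Polynomial.aeval (r * a + c * z) (Polynomial.hermite n)
            ∂gaussianReal 0 1 := by
          congr 1; ext z; rw [aeval_hermite_succ_succ]; ring
      _ = (r * a) * (r ^ (n + 1) * Polynomial.aeval a (Polynomial.hermite (n + 1)))
          + c * (c * ((n + 1) * (r ^ n * Polynomial.aeval a (Polynomial.hermite n))))
          - (n + 1) * (r ^ n * Polynomial.aeval a (Polynomial.hermite n)) := by
          rw [integral_sub (((hint _).const_mul _).fun_add (hint2.const_mul _))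
            ((hint _).const_mul _), integral_add ((hint _).const_mul _) (hint2.const_mul _),
            integral_const_mul, integral_const_mul, integral_const_mul, hstein,
            ih _ (by omega), ih _ (by omega)]
      _ = _ := by
          rw [aeval_hermite_succ_succ]
          linear_combination ((n + 1) * (r ^ n * Polynomial.aeval a (Polynomial.hermite n))) * hrc

end HermiteMehler

section StdGaussian

theorem hasSum_pow_div_factorial_exp (x : ℝ) :
    HasSum (fun n : ℕ => x ^ n / n.factorial) (Real.exp x) := by
  rw [Real.exp_eq_exp_ℝ]
  exact NormedSpace.expSeries_div_hasSum_exp x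

theorem hasSum_pow_div_factorial_cexp (x : ℂ) :
    HasSum (fun n : ℕ => x ^ n / n.factorial) (Complex.exp x) := by
  rw [Complex.exp_eq_exp_ℂ]
  exact NormedSpace.expSeries_div_hasSum_exp x

variable {E : Type*} [NormedAddCommGroup E] [InnerProductSpace ℝ E] [FiniteDimensional ℝ E]
  [MeasurableSpace E] [BorelSpace E]

theorem measurePreserving_inner_stdGaussian {h : E} (hh : ‖h‖ = 1) :
    MeasurePreserving (fun x : E => inner ℝ h x) (stdGaussian E) (gaussianReal 0 1) := by
  refine ⟨by fun_prop, ?_⟩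
  have := IsGaussian.map_eq_gaussianReal (μ := stdGaussian E) (innerSL ℝ h)
  rw [variance_dual_stdGaussian, integral_strongDual_stdGaussian, innerSL_apply_norm, hh] at this
  simpa using this

theorem integrable_exp_inner_stdGaussian (t : E) :
    Integrable (fun x : E => Real.exp (inner ℝ t x)) (stdGaussian E) := by
  have h := IsGaussian.map_eq_gaussianReal (μ := stdGaussian E) (innerSL ℝ t)
  have h2 := integrable_exp_mul_gaussianReal (μ := (stdGaussian E)[innerSL ℝ t])
    (v := Var[innerSL ℝ t; stdGaussian E].toNNReal) 1
  rw [← h, integrable_map_measure (by fun_prop) (by fun_prop)] at h2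
  simpa [Function.comp_def] using h2

theorem memLp_exp_abs_inner_stdGaussian (t : E) :
    MemLp (fun x : E => Real.exp |inner ℝ t x|) 2 (stdGaussian E) := by
  rw [memLp_two_iff_integrable_sq (by fun_prop)]
  have h1 := integrable_exp_inner_stdGaussian ((2 : ℝ) • t)
  have h2 := integrable_exp_inner_stdGaussian (-(2 : ℝ) • t)
  simp only [real_inner_smul_left] at h1 h2
  refine (integrable_exp_mul_abs h1 h2).congr (.of_forall fun x => ?_)
  simp only [sq, ← Real.exp_add]
  ring_nf

/-- Polynomials in linear functionals are total in `L²` of a standard Gaussian measure. -/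
theorem ae_eq_zero_of_forall_integral_inner_pow_mul_eq_zero {f : E → ℝ}
    (hf : MemLp f 2 (stdGaussian E))
    (h : ∀ (t : E) (n : ℕ), ∫ x, (inner ℝ t x) ^ n * f x ∂stdGaussian E = 0) :
    f =ᵐ[stdGaussian E] 0 := by
  have hf1 : Integrable f (stdGaussian E) := hf.integrable (by norm_num)
  have hexp : ∀ t : E, ∫ x, Complex.exp (inner ℝ t x * Complex.I) * f x ∂stdGaussian E = 0 := by
    intro t
    have hb : ∀ x, HasSum (fun n : ℕ => |inner ℝ t x| ^ n / n.factorial * |f x|)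
        (Real.exp |inner ℝ t x| * |f x|) := by
      intro x
      exact (hasSum_pow_div_factorial_exp _).mul_right _
    have key := hasSum_integral_of_dominated_convergence (μ := stdGaussian E)
      (F := fun (n : ℕ) x => (inner ℝ t x * Complex.I) ^ n / n.factorial * (f x : ℂ))
      (f := fun x => Complex.exp (inner ℝ t x * Complex.I) * f x)
      (fun n x => |inner ℝ t x| ^ n / n.factorial * |f x|)
      (fun n => by
        refine AEStronglyMeasurable.mul (by fun_prop) ?_
        exact Complex.continuous_ofReal.comp_aestronglyMeasurable hf.1)
      (fun n => .of_forall fun x => by simp)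
      (.of_forall fun x => (hb x).summable)
      (by
        simp_rw [fun x => (hb x).tsum_eq]
        exact (memLp_exp_abs_inner_stdGaussian t).integrable_mul hf.abs)
      (.of_forall fun x => by
        exact (hasSum_pow_div_factorial_cexp _).mul_right _)
    refine key.unique ?_
    convert! hasSum_zero with n
    have : ∀ x, (inner ℝ t x * Complex.I) ^ n / n.factorial * (f x : ℂ)
        = Complex.I ^ n / n.factorial * (((inner ℝ t x) ^ n * f x : ℝ) : ℂ) := by
      intro x; push_cast; ring
    simp_rw [this]
    rw [integral_const_mul, integral_complex_ofReal, h t n]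
    simp
  have hfm : AEMeasurable f (stdGaussian E) := hf.1.aemeasurable
  have := isFiniteMeasure_withDensity_ofReal hf1.2
  have := isFiniteMeasure_withDensity_ofReal hf1.neg.2
  have hν : (stdGaussian E).withDensity (fun x => ENNReal.ofReal (f x))
      = (stdGaussian E).withDensity (fun x => ENNReal.ofReal ((-f) x)) := by
    apply Measure.ext_of_charFun
    ext t
    rw [charFun_apply, charFun_apply,
      integral_withDensity_eq_integral_toReal_smul₀ (by fun_prop) (by simp),
      integral_withDensity_eq_integral_toReal_smul₀ (by fun_prop) (by simp),
      ← sub_eq_zero, ← integral_sub, ← hexp t]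
    · congr 1
      ext x
      rw [← sub_smul, real_inner_comm, ENNReal.toReal_ofReal', ENNReal.toReal_ofReal',
        Pi.neg_apply, max_zero_sub_max_neg_zero_eq_self, Complex.real_smul, mul_comm]
    all_goals
      refine Integrable.smul_of_top_left ?_ (memLp_top_of_bound (by fun_prop) 1 (.of_forall ?_))
    · simpa [ENNReal.toReal_ofReal'] using hf1.pos_part.ofReal (𝕜 := ℂ)
    · intro x; simp [Complex.norm_exp_ofReal_mul_I]
    · simpa [ENNReal.toReal_ofReal'] using hf1.neg_part.ofReal (𝕜 := ℂ)
    · intro x; simp [Complex.norm_exp_ofReal_mul_I]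
  rw [withDensity_eq_iff_of_sigmaFinite (by fun_prop) (by fun_prop)] at hν
  filter_upwards [hν] with x hx
  have := congrArg ENNReal.toReal hx
  rw [ENNReal.toReal_ofReal', ENNReal.toReal_ofReal', Pi.neg_apply, ← sub_eq_zero,
    max_zero_sub_max_neg_zero_eq_self] at this
  exact this

/-- Rotation invariance of the product of two standard Gaussian measures. -/
theorem measurePreserving_rotation_stdGaussian (θ : ℝ) :
    MeasurePreserving (ContinuousLinearMap.rotation (E := E) θ)
      ((stdGaussian E).prod (stdGaussian E)) ((stdGaussian E).prod (stdGaussian E)) :=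
  ⟨by fun_prop, IsGaussian.map_rotation_eq_self (by simp) θ⟩

theorem measurePreserving_cos_smul_add_sin_smul_stdGaussian (θ : ℝ) :
    MeasurePreserving (fun z : E × E => Real.cos θ • z.1 + Real.sin θ • z.2)
      ((stdGaussian E).prod (stdGaussian E)) (stdGaussian E) :=
  measurePreserving_fst.comp (measurePreserving_rotation_stdGaussian θ)

/-- The Mehler formula: Hermite polynomials of a normalized linear functional are eigenfunctions. -/
theorem integral_aeval_hermite_inner_stdGaussian (n : ℕ) {h : E} (hh : ‖h‖ = 1) (θ : ℝ) (x : E) :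
    ∫ z, Polynomial.aeval (inner ℝ h (Real.cos θ • x + Real.sin θ • z)) (Polynomial.hermite n)
      ∂stdGaussian E = Real.cos θ ^ n * Polynomial.aeval (inner ℝ h x) (Polynomial.hermite n) := by
  rw [← integral_aeval_hermite_gaussianReal n _ _ (Real.cos_sq_add_sin_sq θ),
    ← (measurePreserving_inner_stdGaussian hh).map_eq, integral_map]
  · simp [inner_add_right, real_inner_smul_right]
  · fun_prop
  · have : Continuous fun z : ℝ => Polynomial.aeval (Real.cos θ * inner ℝ h x + Real.sin θ * z)
      (Polynomial.hermite n) := by fun_prop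
    exact this.aestronglyMeasurable

theorem memLp_aeval_inner_stdGaussian (P : Polynomial ℤ) {h : E} (hh : ‖h‖ = 1) {r : ℝ≥0∞}
    (hr : r ≠ ∞) :
    MemLp (fun x : E => Polynomial.aeval (inner ℝ h x) P) r (stdGaussian E) := by
  have := (memLp_eval_gaussianReal (P.map (Int.castRingHom ℝ)) hr).comp_measurePreserving
    (measurePreserving_inner_stdGaussian hh)
  refine this.ae_eq (.of_forall fun x => ?_)
  simp [Polynomial.aeval_def, Polynomial.eval₂_eq_eval_map]

end StdGaussian

noncomputable section MehlerOperator

variable {E : Type*} [NormedAddCommGroup E] [InnerProductSpace ℝ E] [FiniteDimensional ℝ E]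
  [MeasurableSpace E] [BorelSpace E]

variable (E) in
/-- Composition with the first projection, on `L²` of a standard Gaussian measure. -/
def gaussianFst : Lp ℝ 2 (stdGaussian E) →ₗᵢ[ℝ]
    Lp ℝ 2 ((stdGaussian E).prod (stdGaussian E)) :=
  Lp.compMeasurePreservingₗᵢ ℝ Prod.fst measurePreserving_fst

variable (E) in
/-- Composition with `(x, z) ↦ cos θ • x + sin θ • z`, on `L²` of a standard Gaussian measure. -/
def gaussianRotate (θ : ℝ) : Lp ℝ 2 (stdGaussian E) →ₗᵢ[ℝ]
    Lp ℝ 2 ((stdGaussian E).prod (stdGaussian E)) :=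
  Lp.compMeasurePreservingₗᵢ ℝ _ (measurePreserving_cos_smul_add_sin_smul_stdGaussian θ)

variable (E) in
/-- The Mehler operator `f ↦ ∫ f (cos θ • x + sin θ • z) dγ(z)` on `L²(γ)`. -/
def mehler (θ : ℝ) : Lp ℝ 2 (stdGaussian E) →L[ℝ] Lp ℝ 2 (stdGaussian E) :=
  (ContinuousLinearMap.adjoint (gaussianFst E).toContinuousLinearMap).comp
    (gaussianRotate E θ).toContinuousLinearMap

theorem inner_mehler_right (θ : ℝ) (f g : Lp ℝ 2 (stdGaussian E)) :
    inner ℝ f (mehler E θ g) = ∫ z, f z.1 * g (Real.cos θ • z.1 + Real.sin θ • z.2)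
      ∂(stdGaussian E).prod (stdGaussian E) := by
  rw [mehler, ContinuousLinearMap.comp_apply, ContinuousLinearMap.adjoint_inner_right,
    L2.inner_def]
  refine integral_congr_ae ?_
  filter_upwards [Lp.coeFn_compMeasurePreserving f (measurePreserving_fst
      (μ := stdGaussian E) (ν := stdGaussian E)),
    Lp.coeFn_compMeasurePreserving g (measurePreserving_cos_smul_add_sin_smul_stdGaussian θ)]
    with z h1 h2
  rw [Function.comp_apply] at h1 h2
  rw [← h1, ← h2, RCLike.inner_apply, conj_trivial, mul_comm]
  rfl

theorem inner_mehler_left (θ : ℝ) (f g : Lp ℝ 2 (stdGaussian E)) :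
    inner ℝ (mehler E θ f) g = inner ℝ f (mehler E (-θ) g) := by
  rw [real_inner_comm, inner_mehler_right, inner_mehler_right,
    ← (measurePreserving_rotation_stdGaussian (E := E) (-θ)).map_eq, integral_map]
  · rw [(measurePreserving_rotation_stdGaussian (E := E) (-θ)).map_eq]
    congr 1
    ext z
    simp only [ContinuousLinearMap.rotation_apply]
    rw [mul_comm]
    congr 2
    simp only [Real.cos_neg, Real.sin_neg, neg_neg, smul_add, smul_smul]
    have := Real.cos_sq_add_sin_sq θ
    match_scalars <;> first | ring1 | linear_combination this
  · exact (by fun_prop : Measurable _).aemeasurable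
  · rw [(measurePreserving_rotation_stdGaussian (E := E) (-θ)).map_eq]
    exact ((Lp.aestronglyMeasurable g).comp_measurePreserving measurePreserving_fst).mul
      ((Lp.aestronglyMeasurable f).comp_measurePreserving
        (measurePreserving_cos_smul_add_sin_smul_stdGaussian θ))

theorem mehler_eq_smul {θ r : ℝ} {φ : Lp ℝ 2 (stdGaussian E)} {ψ : E → ℝ}
    (hφ : φ =ᵐ[stdGaussian E] ψ)
    (hψ : ∀ x, ∫ z, ψ (Real.cos θ • x + Real.sin θ • z) ∂stdGaussian E = r * ψ x) :
    mehler E θ φ = r • φ := by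
  refine ext_inner_left ℝ fun f => ?_
  rw [inner_mehler_right, real_inner_smul_right, L2.inner_def]
  have h1 : MemLp ψ 2 (stdGaussian E) := (memLp_congr_ae hφ).1 (Lp.memLp φ)
  have h2 := (measurePreserving_cos_smul_add_sin_smul_stdGaussian (E := E) θ).quasiMeasurePreserving.ae_eq_comp hφ
  rw [integral_congr_ae (g := fun z : E × E => f z.1 * ψ (Real.cos θ • z.1 + Real.sin θ • z.2))
    (by filter_upwards [h2] with z hz; simp only [Function.comp_apply] at hz; rw [hz]),
    integral_prod, ← integral_const_mul]
  · refine integral_congr_ae ?_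
    filter_upwards [hφ] with x hx
    rw [integral_const_mul, hψ, hx]
    rw [RCLike.inner_apply, conj_trivial]
    ring
  · exact ((Lp.memLp f).comp_measurePreserving measurePreserving_fst).integrable_mul
      (h1.comp_measurePreserving (measurePreserving_cos_smul_add_sin_smul_stdGaussian θ))

end MehlerOperator

section Totality

variable {E : Type*} [NormedAddCommGroup E] [InnerProductSpace ℝ E] [FiniteDimensional ℝ E]
  [MeasurableSpace E] [BorelSpace E]

/-- The Hermite polynomials, as a sequence of real polynomials with one in each degree. -/
noncomputable def hermiteSequence : Polynomial.Sequence ℝ where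
  elems' n := (Polynomial.hermite n).map (Int.castRingHom ℝ)
  degree_eq' n := by
    rw [Polynomial.degree_map_eq_of_injective Int.cast_injective, Polynomial.degree_hermite]

/-- Hermite polynomials in normalized linear functionals are total in `L²(γ)`. -/
theorem ae_eq_zero_of_forall_integral_hermite_mul_eq_zero {f : E → ℝ}
    (hf : MemLp f 2 (stdGaussian E)) (h0 : ∫ x, f x ∂stdGaussian E = 0)
    (h : ∀ (t : E), ‖t‖ = 1 → ∀ n : ℕ,
      ∫ x, Polynomial.aeval (inner ℝ t x) (Polynomial.hermite (n + 1)) * f x ∂stdGaussian E = 0) :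
    f =ᵐ[stdGaussian E] 0 := by
  refine ae_eq_zero_of_forall_integral_inner_pow_mul_eq_zero hf fun t n => ?_
  rcases eq_or_ne t 0 with rfl | ht
  · rcases n with _ | n
    · simpa using h0
    · simp
  set u : E := ‖t‖⁻¹ • t with hu
  have hu1 : ‖u‖ = 1 := by simp [hu, norm_smul, ht]
  have hint : ∀ p : Polynomial ℝ, Integrable (fun x => p.eval (inner ℝ u x) * f x)
      (stdGaussian E) := fun p =>
    ((memLp_eval_gaussianReal p (r := 2) (by simp)).comp_measurePreserving
      (measurePreserving_inner_stdGaussian hu1)).integrable_mul hf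
  let Λ : Polynomial ℝ →ₗ[ℝ] ℝ :=
    { toFun := fun p => ∫ x, p.eval (inner ℝ u x) * f x ∂stdGaussian E
      map_add' := fun p q => by
        simp only [Polynomial.eval_add, add_mul]
        exact integral_add (hint p) (hint q)
      map_smul' := fun c p => by
        simp only [Polynomial.eval_smul, smul_eq_mul, mul_assoc, RingHom.id_apply]
        exact integral_const_mul _ _ }
  have hΛ : Λ = 0 := by
    refine LinearMap.ext_on (hermiteSequence.span fun i => ?_) ?_
    · refine isUnit_iff_ne_zero.2 (Polynomial.leadingCoeff_ne_zero.2 fun h => by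
        have := hermiteSequence.degree_eq i
        simp [h] at this)
    · rintro _ ⟨n, rfl⟩
      rcases n with _ | n
      · simpa [Λ, hermiteSequence] using h0
      · rw [LinearMap.zero_apply, ← h u hu1 n]
        simp only [Λ, hermiteSequence, LinearMap.coe_mk, AddHom.coe_mk, Polynomial.aeval_def,
          Polynomial.eval₂_eq_eval_map, algebraMap_int_eq]
  have hx : ∀ x, inner ℝ t x = ‖t‖ * inner ℝ u x := by
    intro x
    rw [hu, real_inner_smul_left, mul_inv_cancel_left₀ (by simpa using ht)]
  have h1 := LinearMap.congr_fun hΛ (Polynomial.X ^ n)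
  simp only [Λ, LinearMap.coe_mk, AddHom.coe_mk, Polynomial.eval_pow, Polynomial.eval_X,
    LinearMap.zero_apply] at h1
  simp_rw [hx, mul_pow, mul_assoc]
  rw [integral_const_mul, h1, mul_zero]

end Totality

section Chaos

variable {Ω : Type*} [MeasurableSpace Ω] {P : Measure Ω} {N : ℕ} {X : Fin N → Ω → ℝ}

theorem exists_measurePreserving_stdGaussian [IsProbabilityMeasure P]
    (hlaw : ∀ i, HasLaw (X i) (gaussianReal 0 1) P) (hind : iIndepFun X P) :
    ∃ Y : Ω → EuclideanSpace ℝ (Fin N),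
      MeasurePreserving Y P (stdGaussian (EuclideanSpace ℝ (Fin N))) ∧
        ∀ᵐ ω ∂P, ∀ i, Y ω i = X i ω := by
  refine ⟨fun ω => WithLp.toLp 2 fun i => (hlaw i).aemeasurable.mk _ ω, ⟨?_, ?_⟩, ?_⟩
  · have : Measurable fun ω => fun i => (hlaw i).aemeasurable.mk _ ω :=
      measurable_pi_lambda _ fun i => (hlaw i).aemeasurable.measurable_mk
    fun_prop
  · have h1 := (iIndepFun_iff_map_fun_eq_pi_map fun i => (hlaw i).aemeasurable).1 hind
    simp_rw [fun i => (hlaw i).map_eq] at h1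
    have h2 : (fun ω i => X i ω) =ᵐ[P] fun ω i => (hlaw i).aemeasurable.mk _ ω := by
      filter_upwards [ae_all_iff.2 fun i => (hlaw i).aemeasurable.ae_eq_mk] with ω hω
      ext i
      exact hω i
    rw [← map_pi_eq_stdGaussian, ← h1, Measure.map_congr h2, Measure.map_map (by fun_prop)
      (measurable_pi_lambda _ fun i => (hlaw i).aemeasurable.measurable_mk)]
    rfl
  · filter_upwards [ae_all_iff.2 fun i => (hlaw i).aemeasurable.ae_eq_mk] with ω hω i
    exact (hω i).symm

variable {Y : Ω → EuclideanSpace ℝ (Fin N)}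

omit [MeasurableSpace Ω] in
theorem gaussianSum_eq_inner {ω : Ω} (hω : ∀ i, Y ω i = X i ω)
    (h : EuclideanSpace ℝ (Fin N)) : gaussianSum X h ω = inner ℝ h (Y ω) := by
  simp [gaussianSum, PiLp.inner_apply, hω, mul_comm]

theorem coeFn_compMeasurePreservingₗᵢ
    (hY : MeasurePreserving Y P (stdGaussian (EuclideanSpace ℝ (Fin N))))
    {φ : Lp ℝ 2 (stdGaussian (EuclideanSpace ℝ (Fin N)))} {ψ : EuclideanSpace ℝ (Fin N) → ℝ}
    (hφ : φ =ᵐ[stdGaussian (EuclideanSpace ℝ (Fin N))] ψ) :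
    Lp.compMeasurePreservingₗᵢ ℝ Y hY φ =ᵐ[P] fun ω => ψ (Y ω) :=
  (Lp.coeFn_compMeasurePreserving φ hY).trans (hY.quasiMeasurePreserving.ae_eq_comp hφ)

theorem compMeasurePreservingₗᵢ_mem_chaosGenerators_zero
    (hY : MeasurePreserving Y P (stdGaussian (EuclideanSpace ℝ (Fin N))))
    {φ : Lp ℝ 2 (stdGaussian (EuclideanSpace ℝ (Fin N)))} {c : ℝ}
    (hφ : φ =ᵐ[stdGaussian (EuclideanSpace ℝ (Fin N))] fun _ => c) :
    Lp.compMeasurePreservingₗᵢ ℝ Y hY φ ∈ chaosGenerators P X 0 :=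
  ⟨c, coeFn_compMeasurePreservingₗᵢ hY hφ⟩

theorem compMeasurePreservingₗᵢ_mem_chaosGenerators_succ
    (hY : MeasurePreserving Y P (stdGaussian (EuclideanSpace ℝ (Fin N))))
    (hYX : ∀ᵐ ω ∂P, ∀ i, Y ω i = X i ω) {n : ℕ}
    {φ : Lp ℝ 2 (stdGaussian (EuclideanSpace ℝ (Fin N)))} {h : EuclideanSpace ℝ (Fin N)}
    (hh : ‖h‖ = 1) (hφ : φ =ᵐ[stdGaussian (EuclideanSpace ℝ (Fin N))]
      fun x => Polynomial.aeval (inner ℝ h x) (Polynomial.hermite (n + 1))) :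
    Lp.compMeasurePreservingₗᵢ ℝ Y hY φ ∈ chaosGenerators P X (n + 1) := by
  refine ⟨h, hh, ?_⟩
  filter_upwards [coeFn_compMeasurePreservingₗᵢ hY hφ, hYX] with ω h1 h2
  rw [gaussianSum_eq_inner h2, h1]

/-- Every generator of the `n`-th chaos comes from an eigenvector of the Mehler operators. -/
theorem exists_mehler_eq_of_mem_chaosGenerators
    (hY : MeasurePreserving Y P (stdGaussian (EuclideanSpace ℝ (Fin N))))
    (hYX : ∀ᵐ ω ∂P, ∀ i, Y ω i = X i ω) {n : ℕ} {F : Lp ℝ 2 P}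
    (hF : F ∈ chaosGenerators P X n) :
    ∃ φ, F = Lp.compMeasurePreservingₗᵢ ℝ Y hY φ ∧
      ∀ θ, mehler _ θ φ = Real.cos θ ^ n • φ := by
  rcases n with _ | n
  · obtain ⟨c, hc⟩ := hF
    have hm : MemLp (fun _ : EuclideanSpace ℝ (Fin N) => c) 2
      (stdGaussian (EuclideanSpace ℝ (Fin N))) := memLp_const c
    refine ⟨hm.toLp, ?_, fun θ => mehler_eq_smul hm.coeFn_toLp (by simp)⟩
    exact Lp.ext (hc.trans (coeFn_compMeasurePreservingₗᵢ hY hm.coeFn_toLp).symm)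
  · obtain ⟨h, hh, hFh⟩ := hF
    have hm := memLp_aeval_inner_stdGaussian (Polynomial.hermite (n + 1)) hh
      (r := 2) (by simp)
    refine ⟨hm.toLp, ?_, fun θ => mehler_eq_smul hm.coeFn_toLp
      fun x => integral_aeval_hermite_inner_stdGaussian _ hh θ x⟩
    refine Lp.ext (hFh.trans ?_)
    filter_upwards [coeFn_compMeasurePreservingₗᵢ hY hm.coeFn_toLp, hYX] with ω h1 h2
    rw [gaussianSum_eq_inner h2, h1]

theorem inner_eq_zero_of_mem_chaosGenerators
    (hY : MeasurePreserving Y P (stdGaussian (EuclideanSpace ℝ (Fin N))))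
    (hYX : ∀ᵐ ω ∂P, ∀ i, Y ω i = X i ω) {n m : ℕ} (hnm : n ≠ m) {F G : Lp ℝ 2 P}
    (hF : F ∈ chaosGenerators P X n) (hG : G ∈ chaosGenerators P X m) : inner ℝ F G = 0 := by
  obtain ⟨φ, rfl, hφ⟩ := exists_mehler_eq_of_mem_chaosGenerators hY hYX hF
  obtain ⟨ψ, rfl, hψ⟩ := exists_mehler_eq_of_mem_chaosGenerators hY hYX hG
  rw [LinearIsometry.inner_map_map]
  have h1 := inner_mehler_left (Real.pi / 3) φ ψ
  rw [hφ, hψ, real_inner_smul_left, real_inner_smul_right, Real.cos_neg, Real.cos_pi_div_three] at h1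
  by_contra h0
  exact hnm (pow_right_injective₀ (by norm_num) (by norm_num) (mul_right_cancel₀ h0 h1))

theorem wienerChaos_isOrtho
    (hY : MeasurePreserving Y P (stdGaussian (EuclideanSpace ℝ (Fin N))))
    (hYX : ∀ᵐ ω ∂P, ∀ i, Y ω i = X i ω) {n m : ℕ} (hnm : n ≠ m) :
    wienerChaos P X n ⟂ wienerChaos P X m := by
  have : Submodule.span ℝ (chaosGenerators P X n) ⟂ Submodule.span ℝ (chaosGenerators P X m) :=
    Submodule.isOrtho_span.2 fun F hF G hG => inner_eq_zero_of_mem_chaosGenerators hY hYX hnm hF hG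
  refine Submodule.topologicalClosure_minimal _ ?_ (Submodule.isClosed_orthogonal _)
  rwa [wienerChaos, Submodule.orthogonal_closure]

theorem mem_wienerChaos_of_mem_chaosGenerators {n : ℕ} {F : Lp ℝ 2 P}
    (hF : F ∈ chaosGenerators P X n) : F ∈ wienerChaos P X n :=
  Submodule.le_topologicalClosure _ (Submodule.subset_span hF)

theorem inner_ouSemigroup_of_mem_chaosGenerators
    (hY : MeasurePreserving Y P (stdGaussian (EuclideanSpace ℝ (Fin N))))
    (hYX : ∀ᵐ ω ∂P, ∀ i, Y ω i = X i ω) {t : ℝ} (ht : 0 < t) {n : ℕ} {G : Lp ℝ 2 P}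
    (hG : G ∈ chaosGenerators P X n) (F : Lp ℝ 2 P) :
    inner ℝ G (ouSemigroup P X t F) = Real.exp (-t) ^ n * inner ℝ G F := by
  have h1 := (hasSum_ouSemigroup P X ht F).mapL (innerSL ℝ G)
  have hG' := mem_wienerChaos_of_mem_chaosGenerators hG
  have h2 : ∀ m : ℕ, innerSL ℝ G (Real.exp (-(m * t)) • chaosProj P X m F)
      = Real.exp (-(m * t)) * inner ℝ (chaosProj P X m G) F := by
    intro m
    rw [map_smul, innerSL_apply_apply, chaosProj, ← Submodule.inner_starProjection_left_eq_right,
      smul_eq_mul]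
  simp_rw [h2] at h1
  refine h1.unique ?_
  have h3 : Real.exp (-t) ^ n * inner ℝ G F
      = Real.exp (-(n * t)) * inner ℝ (chaosProj P X n G) F := by
    rw [chaosProj, Submodule.starProjection_eq_self_iff.2 hG', ← Real.exp_nat_mul, mul_neg]
  rw [h3]
  refine hasSum_single n fun m hm => ?_
  rw [chaosProj, (Submodule.starProjection_apply_eq_zero_iff _).2, inner_zero_left, mul_zero]
  exact (wienerChaos_isOrtho hY hYX hm.symm).le hG'

theorem ouSemigroup_mem_range
    (hY : MeasurePreserving Y P (stdGaussian (EuclideanSpace ℝ (Fin N))))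
    (hYX : ∀ᵐ ω ∂P, ∀ i, Y ω i = X i ω) {t : ℝ} (ht : 0 < t) (F : Lp ℝ 2 P) :
    ouSemigroup P X t F ∈ (Lp.compMeasurePreservingₗᵢ ℝ Y hY :
      Lp ℝ 2 (stdGaussian (EuclideanSpace ℝ (Fin N))) →ₗᵢ[ℝ] Lp ℝ 2 P).toLinearMap.range := by
  set R := (Lp.compMeasurePreservingₗᵢ ℝ Y hY :
      Lp ℝ 2 (stdGaussian (EuclideanSpace ℝ (Fin N))) →ₗᵢ[ℝ] Lp ℝ 2 P).toLinearMap.range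
  have hR : IsClosed (R : Set (Lp ℝ 2 P)) := by
    have := (Lp.compMeasurePreservingₗᵢ ℝ Y hY :
      Lp ℝ 2 (stdGaussian (EuclideanSpace ℝ (Fin N))) →ₗᵢ[ℝ] Lp ℝ 2 P).isometry.isClosedEmbedding.isClosed_range
    convert! this using 1
  have hle : ∀ n, wienerChaos P X n ≤ R := fun n =>
    Submodule.topologicalClosure_minimal _ (Submodule.span_le.2 fun G hG => by
      obtain ⟨φ, rfl, -⟩ := exists_mehler_eq_of_mem_chaosGenerators hY hYX hG
      exact ⟨φ, rfl⟩) hR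
  refine hR.mem_of_tendsto (hasSum_ouSemigroup P X ht F) (.of_forall fun s => ?_)
  exact R.sum_mem fun n _ => R.smul_mem _ (hle n (Submodule.starProjection_apply_mem _ _))

/-- The Ornstein–Uhlenbeck semigroup is the lift to `Ω` of the Mehler operator. -/
theorem ouSemigroup_eq_mehler
    (hY : MeasurePreserving Y P (stdGaussian (EuclideanSpace ℝ (Fin N))))
    (hYX : ∀ᵐ ω ∂P, ∀ i, Y ω i = X i ω) {t θ : ℝ} (ht : 0 < t)
    (hθ : Real.cos θ = Real.exp (-t)) (F : Lp ℝ 2 P) :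
    ouSemigroup P X t F = Lp.compMeasurePreservingₗᵢ ℝ Y hY (mehler _ θ
      (ContinuousLinearMap.adjoint
        (Lp.compMeasurePreservingₗᵢ ℝ Y hY).toContinuousLinearMap F)) := by
  set U : Lp ℝ 2 (stdGaussian (EuclideanSpace ℝ (Fin N))) →ₗᵢ[ℝ] Lp ℝ 2 P :=
    Lp.compMeasurePreservingₗᵢ ℝ Y hY with hU
  obtain ⟨δ, hδ⟩ := ouSemigroup_mem_range hY hYX ht F
  rw [LinearIsometry.coe_toLinearMap] at hδ
  rw [← hδ, U.injective.eq_iff, ← sub_eq_zero]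
  have hgen : ∀ (n : ℕ) (φ : Lp ℝ 2 (stdGaussian (EuclideanSpace ℝ (Fin N)))),
      U φ ∈ chaosGenerators P X n → inner ℝ φ (δ - mehler _ θ
        (ContinuousLinearMap.adjoint U.toContinuousLinearMap F)) = 0 := by
    intro n φ hφ
    have h1 := inner_ouSemigroup_of_mem_chaosGenerators hY hYX ht hφ F
    obtain ⟨ψ, hψ, hψ'⟩ := exists_mehler_eq_of_mem_chaosGenerators hY hYX hφ
    obtain rfl := U.injective hψ
    rw [inner_sub_right, ← U.inner_map_map, hδ, h1, ← neg_neg θ, ← inner_mehler_left, hψ',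
      real_inner_smul_left, ContinuousLinearMap.adjoint_inner_right, Real.cos_neg, hθ]
    exact sub_self _
  generalize δ - mehler _ θ (ContinuousLinearMap.adjoint U.toContinuousLinearMap F) = D at hgen ⊢
  refine (Lp.eq_zero_iff_ae_eq_zero).2
    (ae_eq_zero_of_forall_integral_hermite_mul_eq_zero (Lp.memLp _) ?_ fun h hh n => ?_)
  · obtain ⟨φ, hφ⟩ : ∃ φ : Lp ℝ 2 (stdGaussian (EuclideanSpace ℝ (Fin N))),
        φ =ᵐ[stdGaussian (EuclideanSpace ℝ (Fin N))] fun _ => (1 : ℝ) :=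
      ⟨(memLp_const 1).toLp, (memLp_const 1).coeFn_toLp⟩
    rw [← hgen 0 φ (compMeasurePreservingₗᵢ_mem_chaosGenerators_zero hY hφ), L2.inner_def]
    refine integral_congr_ae ?_
    filter_upwards [hφ] with x hx
    rw [hx, RCLike.inner_apply, conj_trivial, mul_one]
  · have hm := memLp_aeval_inner_stdGaussian (Polynomial.hermite (n + 1)) hh (r := 2) (by simp)
    obtain ⟨φ, hφ⟩ : ∃ φ : Lp ℝ 2 (stdGaussian (EuclideanSpace ℝ (Fin N))),
        φ =ᵐ[stdGaussian (EuclideanSpace ℝ (Fin N))] fun x =>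
          Polynomial.aeval (inner ℝ h x) (Polynomial.hermite (n + 1)) :=
      ⟨hm.toLp, hm.coeFn_toLp⟩
    rw [← hgen (n + 1) φ (compMeasurePreservingₗᵢ_mem_chaosGenerators_succ hY hYX hh hφ),
      L2.inner_def]
    refine integral_congr_ae ?_
    filter_upwards [hφ] with x hx
    rw [hx, RCLike.inner_apply, conj_trivial, mul_comm]

/-- Spectral gap: the semigroup contracts the orthogonal complement of the constants. -/
theorem norm_ouSemigroup_le
    (hY : MeasurePreserving Y P (stdGaussian (EuclideanSpace ℝ (Fin N))))
    (hYX : ∀ᵐ ω ∂P, ∀ i, Y ω i = X i ω) {t : ℝ} (ht : 0 < t) {F : Lp ℝ 2 P}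
    (hF : chaosProj P X 0 F = 0) :
    ‖ouSemigroup P X t F‖ ≤ Real.exp (-t) * ‖F‖ := by
  have hV : OrthogonalFamily ℝ (fun n => wienerChaos P X n)
      fun n => (wienerChaos P X n).subtypeₗᵢ :=
    OrthogonalFamily.of_pairwise fun n m hnm => wienerChaos_isOrtho hY hYX hnm
  have hsum : ∀ (s : Finset ℕ) (c : ℕ → ℝ),
      ‖∑ n ∈ s, c n • chaosProj P X n F‖ ^ 2 = ∑ n ∈ s, c n ^ 2 * ‖chaosProj P X n F‖ ^ 2 := by
    intro s c
    have := hV.norm_sum (fun n => c n • ⟨chaosProj P X n F,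
      Submodule.starProjection_apply_mem _ _⟩) s
    simpa [norm_smul, mul_pow] using this
  have hbessel : ∀ s : Finset ℕ, ∑ n ∈ s, ‖chaosProj P X n F‖ ^ 2 ≤ ‖F‖ ^ 2 := by
    intro s
    have h1 := hsum s fun _ => 1
    simp only [one_smul, one_pow, one_mul] at h1
    have h2 : inner ℝ F (∑ n ∈ s, chaosProj P X n F) = ∑ n ∈ s, ‖chaosProj P X n F‖ ^ 2 := by
      rw [inner_sum]
      refine Finset.sum_congr rfl fun n _ => ?_
      rw [← real_inner_self_eq_norm_sq, chaosProj, Submodule.inner_starProjection_left_eq_right,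
        (Submodule.starProjection_eq_self_iff).2 (Submodule.starProjection_apply_mem _ _)]
    have h3 := real_inner_le_norm F (∑ n ∈ s, chaosProj P X n F)
    rw [h2, ← h1] at h3
    rw [← h1]
    nlinarith [norm_nonneg F, norm_nonneg (∑ n ∈ s, chaosProj P X n F)]
  refine le_of_tendsto (hasSum_ouSemigroup P X ht F).norm (.of_forall fun s => ?_)
  refine abs_le_of_sq_le_sq' ?_ (by positivity) |>.2
  rw [hsum, mul_pow]
  refine le_trans ?_ (mul_le_mul_of_nonneg_left (hbessel s) (sq_nonneg _))
  rw [Finset.mul_sum]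
  refine Finset.sum_le_sum fun n _ => ?_
  rcases Nat.eq_zero_or_pos n with rfl | hn
  · simp [hF]
  · gcongr
    have : (1 : ℝ) ≤ n := by exact_mod_cast hn
    nlinarith

end Chaos

section RpowTaylor

theorem one_add_mul_le_one_add_rpow_of_nonpos {p x : ℝ} (hp : p ≤ 0) (hx : -1 < x) :
    1 + p * x ≤ (1 + x) ^ p := by
  have hx' : 0 < 1 + x := by linarith
  rw [Real.rpow_def_of_pos hx']
  have h1 := Real.add_one_le_exp (Real.log (1 + x) * p)
  have h2 := Real.log_le_sub_one_of_pos hx'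
  nlinarith

theorem one_add_rpow_le_taylor {a x : ℝ} (ha0 : 0 < a) (ha1 : a < 1) (hx : -1 < x) :
    (1 + x) ^ a ≤ 1 + a * x + a * (a - 1) / 2 * x ^ 2 + a * (a - 1) * (a - 2) / 6 * x ^ 3 := by
  have hr : ∀ (p y : ℝ), -1 < y →
      HasDerivAt (fun y => (1 + y) ^ p) (p * (1 + y) ^ (p - 1)) y := by
    intro p y hy
    have := ((hasDerivAt_id y).const_add 1).rpow_const (p := p) (Or.inl (by simp; linarith))
    convert! this using 1
    simp
  set G : ℝ → ℝ := fun y => 1 + (a - 1) * y + (a - 1) * (a - 2) / 2 * y ^ 2 - (1 + y) ^ (a - 1)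
    with hG
  set F : ℝ → ℝ := fun y => 1 + a * y + a * (a - 1) / 2 * y ^ 2
    + a * (a - 1) * (a - 2) / 6 * y ^ 3 - (1 + y) ^ a with hF
  have hGd : ∀ y, -1 < y →
      HasDerivAt G ((a - 1) * (1 + (a - 2) * y - (1 + y) ^ (a - 2))) y := by
    intro y hy
    have h := ((((hasDerivAt_id y).const_mul (a - 1)).const_add 1).add
      ((hasDerivAt_pow 2 y).const_mul ((a - 1) * (a - 2) / 2))).sub (hr (a - 1) y hy)
    convert! h using 1
    rw [show a - 1 - 1 = a - 2 by ring]
    push_cast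
    ring
  have hFd : ∀ y, -1 < y → HasDerivAt F (a * G y) y := by
    intro y hy
    have h := (((((hasDerivAt_id y).const_mul a).const_add 1).add
      ((hasDerivAt_pow 2 y).const_mul (a * (a - 1) / 2))).add
      ((hasDerivAt_pow 3 y).const_mul (a * (a - 1) * (a - 2) / 6))).sub (hr a y hy)
    convert! h using 1
    simp only [hG]
    push_cast
    ring
  have hGmono : MonotoneOn G (Set.Ioi (-1)) := by
    refine monotoneOn_of_deriv_nonneg (convex_Ioi _)
      (fun y hy => (hGd y hy).continuousAt.continuousWithinAt)
      (fun y hy => ?_) fun y hy => ?_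
    · rw [interior_Ioi] at hy
      exact (hGd y hy).differentiableAt.differentiableWithinAt
    · rw [interior_Ioi] at hy
      rw [(hGd y hy).deriv]
      have := one_add_mul_le_one_add_rpow_of_nonpos (p := a - 2) (by linarith) hy
      nlinarith
  have hG0 : G 0 = 0 := by simp [hG]
  have hF0 : F 0 = 0 := by simp [hF]
  suffices 0 ≤ F x by simp only [hF] at this; linarith
  rcases le_total 0 x with h | h
  · have : MonotoneOn F (Set.Ici 0) := by
      refine monotoneOn_of_deriv_nonneg (convex_Ici _)
        (fun y hy => (hFd y (by simp at hy; linarith)).continuousAt.continuousWithinAt)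
        (fun y hy => ?_) fun y hy => ?_
      all_goals
        rw [interior_Ici, Set.mem_Ioi] at hy
        have hy1 : -1 < y := by linarith
      · exact (hFd y hy1).differentiableAt.differentiableWithinAt
      · rw [(hFd y hy1).deriv]
        have := hGmono (by simp : (0 : ℝ) ∈ Set.Ioi (-1)) hy1 hy.le
        rw [hG0] at this
        positivity
    rw [← hF0]
    exact this (Set.self_mem_Ici) h h
  · have : AntitoneOn F (Set.Ioc (-1) 0) := by
      refine antitoneOn_of_deriv_nonpos (convex_Ioc _ _)
        (fun y hy => (hFd y hy.1).continuousAt.continuousWithinAt)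
        (fun y hy => ?_) fun y hy => ?_
      all_goals
        rw [interior_Ioc, Set.mem_Ioo] at hy
      · exact (hFd y hy.1).differentiableAt.differentiableWithinAt
      · rw [(hFd y hy.1).deriv]
        have := hGmono hy.1 (by simp : (0 : ℝ) ∈ Set.Ioi (-1)) hy.2.le
        rw [hG0] at this
        exact mul_nonpos_of_nonneg_of_nonpos ha0.le this
    rw [← hF0]
    exact this ⟨hx, h⟩ (by simp) h

theorem one_add_rpow_le_abs {a x : ℝ} (ha0 : 0 < a) (ha1 : a < 1) (hx : -1 < x) :
    (1 + x) ^ a ≤ 1 + a * x - a * (1 - a) / 2 * x ^ 2 + |x| ^ 3 := by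
  have h := one_add_rpow_le_taylor ha0 ha1 hx
  have h1 : x ^ 3 ≤ |x| ^ 3 := by
    rw [← abs_pow]; exact le_abs_self _
  have h2 : 0 ≤ a * (a - 1) * (a - 2) / 6 := by
    have := mul_pos (mul_pos ha0 (sub_pos.2 ha1)) (by linarith : 0 < 2 - a)
    linarith
  have h3 : a * (a - 1) * (a - 2) / 6 ≤ 1 := by nlinarith [mul_pos ha0 (sub_pos.2 ha1)]
  have h4 : 0 ≤ |x| ^ 3 := by positivity
  nlinarith [mul_le_mul_of_nonneg_left h1 h2, mul_le_mul_of_nonneg_right h3 h4]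

theorem one_add_rpow_mul_one_add_rpow_le {a b x y R : ℝ} (ha0 : 0 < a) (ha1 : a < 1) (hb0 : 0 < b)
    (hb1 : b < 1) (hx : -1 < x) (hy : -1 < y) (hR : 1 ≤ R) (hxR : |x| ≤ R) (hyR : |y| ≤ R) :
    (1 + x) ^ a * (1 + y) ^ b ≤ 1 + a * x + b * y + a * b * (x * y) - a * (1 - a) / 2 * x ^ 2
      - b * (1 - b) / 2 * y ^ 2 + 10 * R ^ 3 * (|x| ^ 3 + |y| ^ 3) := by
  have hA := one_add_rpow_le_abs ha0 ha1 hx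
  have hB := one_add_rpow_le_abs hb0 hb1 hy
  have h1x : 0 < (1 + x) ^ a := Real.rpow_pos_of_pos (by linarith) _
  have h1y : 0 < (1 + y) ^ b := Real.rpow_pos_of_pos (by linarith) _
  refine (mul_le_mul hA hB h1y.le (h1x.le.trans hA)).trans ?_
  set X := |x| with hX
  set Y := |y| with hY
  have hX0 : 0 ≤ X := abs_nonneg _
  have hY0 : 0 ≤ Y := abs_nonneg _
  set S := X ^ 3 + Y ^ 3 with hS
  have hS0 : 0 ≤ S := by positivity
  have hX3 : X ^ 3 ≤ S := by have : 0 ≤ Y ^ 3 := by positivity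
                             linarith
  have hY3 : Y ^ 3 ≤ S := by have : 0 ≤ X ^ 3 := by positivity
                             linarith
  have hx2 : x ^ 2 = X ^ 2 := (sq_abs x).symm
  have hy2 : y ^ 2 = Y ^ 2 := (sq_abs y).symm
  have e1 : X * Y ^ 2 ≤ S := by
    rcases le_total X Y with h | h
    · nlinarith [mul_le_mul_of_nonneg_right h (sq_nonneg Y)]
    · nlinarith [mul_le_mul_of_nonneg_left (pow_le_pow_left₀ hY0 h 2) hX0]
  have e2 : X ^ 2 * Y ≤ S := by
    rcases le_total X Y with h | h
    · nlinarith [mul_le_mul_of_nonneg_right (pow_le_pow_left₀ hX0 h 2) hY0]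
    · nlinarith [mul_le_mul_of_nonneg_left h (sq_nonneg X)]
  have hR2 : R ≤ R ^ 3 := le_self_pow₀ hR (by norm_num)
  have hR3 : (1 : ℝ) ≤ R ^ 3 := one_le_pow₀ hR
  have f1 : X * Y ^ 3 ≤ R ^ 3 * S :=
    mul_le_mul (hxR.trans hR2) hY3 (by positivity) (by positivity)
  have f2 : X ^ 3 * Y ≤ R ^ 3 * S := by
    rw [mul_comm]
    exact mul_le_mul (hyR.trans hR2) hX3 (by positivity) (by positivity)
  have f3 : X ^ 2 * Y ^ 2 ≤ R ^ 3 * S := by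
    calc X ^ 2 * Y ^ 2 = X * (X * Y ^ 2) := by ring
      _ ≤ R ^ 3 * S := mul_le_mul (hxR.trans hR2) e1 (by positivity) (by positivity)
  have f4 : X ^ 3 * Y ^ 3 ≤ R ^ 3 * S :=
    mul_le_mul (pow_le_pow_left₀ hX0 hxR 3) hY3 (by positivity) (by positivity)
  have f5 : S ≤ R ^ 3 * S := le_mul_of_one_le_left hS0 hR3
  have bnd : ∀ {c m M : ℝ}, 0 ≤ c → c ≤ 1 → |m| ≤ M → c * m ≤ M := by
    intro c m M h0 h1 hm
    calc c * m ≤ c * |m| := mul_le_mul_of_nonneg_left (le_abs_self m) h0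
      _ ≤ |m| := mul_le_of_le_one_left (abs_nonneg m) h1
      _ ≤ M := hm
  have a1 : 0 ≤ 1 - a := by linarith
  have b1 : 0 ≤ 1 - b := by linarith
  have ca : a * (1 - a) / 2 ≤ 1 := by
    have := mul_le_one₀ ha1.le a1 (by linarith : 1 - a ≤ 1)
    linarith
  have cb : b * (1 - b) / 2 ≤ 1 := by
    have := mul_le_one₀ hb1.le b1 (by linarith : 1 - b ≤ 1)
    linarith
  have ca0 : 0 ≤ a * (1 - a) / 2 := by positivity
  have cb0 : 0 ≤ b * (1 - b) / 2 := by positivity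
  have t1 : (a * (b * (1 - b) / 2)) * (-(x * Y ^ 2)) ≤ R ^ 3 * S :=
    bnd (by positivity) (mul_le_one₀ ha1.le cb0 cb)
      (by rw [abs_neg, abs_mul, abs_of_nonneg (sq_nonneg Y)]; exact e1.trans f5)
  have t2 : a * (x * Y ^ 3) ≤ R ^ 3 * S :=
    bnd ha0.le ha1.le (by rw [abs_mul, abs_of_nonneg (pow_nonneg hY0 3)]; exact f1)
  have t3 : (b * (a * (1 - a) / 2)) * (-(X ^ 2 * y)) ≤ R ^ 3 * S :=
    bnd (by positivity) (mul_le_one₀ hb1.le ca0 ca)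
      (by rw [abs_neg, abs_mul, abs_of_nonneg (sq_nonneg X)]; exact e2.trans f5)
  have t4 : (a * (1 - a) / 2 * (b * (1 - b) / 2)) * (X ^ 2 * Y ^ 2) ≤ R ^ 3 * S :=
    bnd (by positivity) (mul_le_one₀ ca cb0 cb) (by rw [abs_of_nonneg (by positivity)]; exact f3)
  have t5 : b * (X ^ 3 * y) ≤ R ^ 3 * S :=
    bnd hb0.le hb1.le (by rw [abs_mul, abs_of_nonneg (pow_nonneg hX0 3)]; exact f2)
  have t6 : 0 ≤ a * (1 - a) / 2 * (X ^ 2 * Y ^ 3) := by positivity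
  have t7 : 0 ≤ b * (1 - b) / 2 * (X ^ 3 * Y ^ 2) := by positivity
  rw [hx2, hy2]
  linarith

end RpowTaylor

section Correlation

variable {N : ℕ}

/-- Maximal correlation of jointly Gaussian vectors. -/
theorem integral_mul_rotate_le {θ : ℝ} (h0 : 0 < Real.cos θ) (h1 : Real.cos θ < 1)
    {f g : EuclideanSpace ℝ (Fin N) → ℝ}
    (hf : MemLp f 2 (stdGaussian (EuclideanSpace ℝ (Fin N))))
    (hg : MemLp g 2 (stdGaussian (EuclideanSpace ℝ (Fin N))))
    (hg0 : ∫ x, g x ∂stdGaussian (EuclideanSpace ℝ (Fin N)) = 0) :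
    ∫ z, f z.1 * g (Real.cos θ • z.1 + Real.sin θ • z.2)
        ∂(stdGaussian (EuclideanSpace ℝ (Fin N))).prod (stdGaussian (EuclideanSpace ℝ (Fin N)))
      ≤ Real.cos θ * (√(∫ x, f x ^ 2 ∂stdGaussian (EuclideanSpace ℝ (Fin N))) *
        √(∫ x, g x ^ 2 ∂stdGaussian (EuclideanSpace ℝ (Fin N)))) := by
  set γ := stdGaussian (EuclideanSpace ℝ (Fin N)) with hγ
  set X : Fin N → EuclideanSpace ℝ (Fin N) → ℝ := fun i x => x i with hX
  have hY : MeasurePreserving id γ γ := MeasurePreserving.id γ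
  have hYX : ∀ᵐ ω ∂γ, ∀ i, (id ω : EuclideanSpace ℝ (Fin N)) i = X i ω :=
    .of_forall fun ω i => rfl
  have hnorm : ∀ {k : EuclideanSpace ℝ (Fin N) → ℝ} (hk : MemLp k 2 γ),
      ‖hk.toLp‖ = √(∫ x, k x ^ 2 ∂γ) := by
    intro k hk
    rw [eq_comm, Real.sqrt_eq_iff_mul_self_eq (by positivity) (norm_nonneg _), ← sq,
      ← real_inner_self_eq_norm_sq, L2.inner_def]
    refine integral_congr_ae ?_
    filter_upwards [hk.coeFn_toLp] with x hx
    rw [hx, RCLike.inner_apply, conj_trivial, sq]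
  set t := -Real.log (Real.cos θ) with ht
  have ht0 : 0 < t := by simpa [ht] using Real.log_neg h0 h1
  have hθ : Real.cos θ = Real.exp (-t) := by rw [ht, neg_neg, Real.exp_log h0]
  set U : Lp ℝ 2 γ →ₗᵢ[ℝ] Lp ℝ 2 γ := Lp.compMeasurePreservingₗᵢ ℝ id hY with hU
  have hproj : chaosProj γ X 0 (U hg.toLp) = 0 := by
    rw [chaosProj, Submodule.starProjection_apply_eq_zero_iff, wienerChaos,
      Submodule.orthogonal_closure, Submodule.mem_orthogonal]
    intro F hF
    induction hF using Submodule.span_induction with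
    | mem F hF =>
      obtain ⟨c, hc⟩ := hF
      rw [L2.inner_def, ← mul_zero c, ← hg0, ← integral_const_mul]
      refine integral_congr_ae ?_
      filter_upwards [hc, coeFn_compMeasurePreservingₗᵢ hY hg.coeFn_toLp] with x h1 h2
      rw [h1, h2, RCLike.inner_apply, conj_trivial, mul_comm, id]
    | zero => simp
    | add F G _ _ hF hG => rw [inner_add_left, hF, hG, add_zero]
    | smul c F _ hF => rw [real_inner_smul_left, hF, mul_zero]
  have hle := norm_ouSemigroup_le hY hYX ht0 hproj
  have hadj : ContinuousLinearMap.adjoint U.toContinuousLinearMap (U hg.toLp) = hg.toLp := by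
    refine ext_inner_left ℝ fun v => ?_
    rw [ContinuousLinearMap.adjoint_inner_right]
    exact U.inner_map_map _ _
  rw [ouSemigroup_eq_mehler hY hYX ht0 hθ, ← hU, hadj, U.norm_map, U.norm_map, ← hθ] at hle
  have hin := (real_inner_le_norm hf.toLp (mehler _ θ hg.toLp)).trans
    (mul_le_mul_of_nonneg_left hle (norm_nonneg _))
  rw [hnorm, hnorm, inner_mehler_right] at hin
  refine le_trans (le_of_eq ?_) (hin.trans (le_of_eq (by ring)))
  refine integral_congr_ae ?_
  filter_upwards [(measurePreserving_fst (μ := γ) (ν := γ)).quasiMeasurePreserving.ae_eq_comp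
      hf.coeFn_toLp, (measurePreserving_cos_smul_add_sin_smul_stdGaussian
        θ).quasiMeasurePreserving.ae_eq_comp hg.coeFn_toLp] with z h1 h2
  simp only [Function.comp_apply] at h1 h2
  rw [h1, h2]

end Correlation

section TwoFunctionInequality

theorem integrable_of_continuous_of_abs_le {α : Type*} [TopologicalSpace α] [MeasurableSpace α]
    [OpensMeasurableSpace α] {μ : Measure α} [IsFiniteMeasure μ] {f : α → ℝ}
    (hf : Continuous f) {C : ℝ} (hC : ∀ x, |f x| ≤ C) : Integrable f μ :=
  Integrable.of_bound hf.measurable.aestronglyMeasurable C (.of_forall hC)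

theorem MeasureTheory.MeasurePreserving.integral_comp_aestronglyMeasurable {α β : Type*}
    {G : Type*} [MeasurableSpace α] [MeasurableSpace β] [NormedAddCommGroup G] [NormedSpace ℝ G]
    {μ : Measure α} {ν : Measure β} {f : α → β}
    (hf : MeasurePreserving f μ ν) {g : β → G} (hg : AEStronglyMeasurable g ν) :
    ∫ x, g (f x) ∂μ = ∫ y, g y ∂ν := by
  rw [← hf.map_eq] at hg ⊢
  exact (integral_map hf.aemeasurable hg).symm

theorem mul_mul_le_of_sq_le {α β κ p q : ℝ} (hα : 0 ≤ α) (hβ : 0 ≤ β)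
    (h : κ ^ 2 ≤ α * β) : κ * (p * q) ≤ α / 2 * p ^ 2 + β / 2 * q ^ 2 := by
  have h1 : |κ| ≤ √α * √β := by
    rw [← Real.sqrt_mul hα]; exact Real.abs_le_sqrt h
  have h2 : κ * (p * q) ≤ |κ| * |p * q| := by rw [← abs_mul]; exact le_abs_self _
  have h3 := mul_le_mul_of_nonneg_right h1 (abs_nonneg (p * q))
  have h4 := sq_nonneg (√α * |p| - √β * |q|)
  have h5 : (√α * |p| - √β * |q|) ^ 2
      = α * p ^ 2 + β * q ^ 2 - 2 * (√α * √β * |p * q|) := by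
    rw [abs_mul, sub_sq, mul_pow, mul_pow, Real.sq_sqrt hα, Real.sq_sqrt hβ, sq_abs, sq_abs]
    ring
  linarith

/-- An approximate Hölder-type inequality for two weakly correlated variables with values in
`[c, C]`, the error being controlled by third central moments. -/
theorem integral_rpow_mul_rpow_le {α : Type*} [MeasurableSpace α] {μ : Measure α}
    [IsProbabilityMeasure μ] {F G : α → ℝ} (hF : Measurable F) (hG : Measurable G)
    {a b c C ρ : ℝ} (ha0 : 0 < a) (ha1 : a < 1) (hb0 : 0 < b) (hb1 : b < 1)
    (hρ : ρ ^ 2 * (a * b) ≤ (1 - a) * (1 - b)) (hc : 0 < c)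
    (hFc : ∀ x, F x ∈ Set.Icc c C) (hGc : ∀ x, G x ∈ Set.Icc c C)
    (hcov : ∫ x, (F x - ∫ y, F y ∂μ) * (G x - ∫ y, G y ∂μ) ∂μ ≤
      ρ * (√(∫ x, (F x - ∫ y, F y ∂μ) ^ 2 ∂μ) * √(∫ x, (G x - ∫ y, G y ∂μ) ^ 2 ∂μ))) :
    ∫ x, F x ^ a * G x ^ b ∂μ ≤ (∫ x, F x ∂μ) ^ a * (∫ x, G x ∂μ) ^ b +
      C ^ a * C ^ b * (10 * (C / c) ^ 3 / c ^ 3) *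
        (∫ x, |F x - ∫ y, F y ∂μ| ^ 3 ∂μ + ∫ x, |G x - ∫ y, G y ∂μ| ^ 3 ∂μ) := by
  have hbd : ∀ {k : α → ℝ} (_ : Measurable k) {D : ℝ} (_ : ∀ x, |k x| ≤ D), Integrable k μ :=
    fun hk D hD => Integrable.of_bound hk.aestronglyMeasurable D (.of_forall hD)
  have hFi : Integrable F μ := hbd hF (D := C) fun x => by
    rw [abs_of_pos (hc.trans_le (hFc x).1)]; exact (hFc x).2
  have hGi : Integrable G μ := hbd hG (D := C) fun x => by
    rw [abs_of_pos (hc.trans_le (hGc x).1)]; exact (hGc x).2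
  set u := ∫ x, F x ∂μ with hu
  set v := ∫ x, G x ∂μ with hv
  have hmean : ∀ {k : α → ℝ} (_ : Integrable k μ) (_ : ∀ x, k x ∈ Set.Icc c C),
      ∫ x, k x ∂μ ∈ Set.Icc c C := fun {k} hk hkc => by
    constructor
    · simpa using integral_mono (integrable_const c) hk fun x => (hkc x).1
    · simpa using integral_mono hk (integrable_const C) fun x => (hkc x).2
  have huc : u ∈ Set.Icc c C := hmean hFi hFc
  have hvc : v ∈ Set.Icc c C := hmean hGi hGc
  have hu0 : 0 < u := hc.trans_le huc.1
  have hv0 : 0 < v := hc.trans_le hvc.1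
  have hC0 : 0 < C := hu0.trans_le huc.2
  have hcC : c ≤ C := huc.1.trans huc.2
  set R := C / c with hR
  have hR1 : 1 ≤ R := (one_le_div hc).2 hcC
  set x : α → ℝ := fun ω => (F ω - u) / u with hx
  set y : α → ℝ := fun ω => (G ω - v) / v with hy
  have hxm : Measurable x := (hF.sub_const u).div_const u
  have hym : Measurable y := (hG.sub_const v).div_const v
  have hgen : ∀ {k w : ℝ}, k ∈ Set.Icc c C → w ∈ Set.Icc c C →
      |(k - w) / w| ≤ R ∧ -1 < (k - w) / w ∧ k = w * (1 + (k - w) / w) := by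
    intro k w hk hw
    have hw0 : 0 < w := hc.trans_le hw.1
    refine ⟨?_, ?_, ?_⟩
    · rw [abs_div, abs_of_pos hw0]
      refine div_le_div₀ hC0.le (abs_le.2 ⟨?_, ?_⟩) hc hw.1 <;> linarith [hk.1, hk.2, hw.1, hw.2]
    · rw [lt_div_iff₀ hw0]; linarith [hk.1]
    · field_simp; ring
  have hxb : ∀ ω, |x ω| ≤ R := fun ω => (hgen (hFc ω) huc).1
  have hyb : ∀ ω, |y ω| ≤ R := fun ω => (hgen (hGc ω) hvc).1
  have hR0 : 0 ≤ R := by linarith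
  have hxi : Integrable x μ := hbd hxm hxb
  have hyi : Integrable y μ := hbd hym hyb
  have hxyi : Integrable (fun ω => x ω * y ω) μ := hbd (hxm.mul hym) (D := R * R) fun ω => by
    rw [abs_mul]; exact mul_le_mul (hxb ω) (hyb ω) (abs_nonneg _) hR0
  have hx2i : Integrable (fun ω => x ω ^ 2) μ := hbd (hxm.pow_const 2) (D := R ^ 2) fun ω => by
    rw [abs_pow]; exact pow_le_pow_left₀ (abs_nonneg _) (hxb ω) 2
  have hy2i : Integrable (fun ω => y ω ^ 2) μ := hbd (hym.pow_const 2) (D := R ^ 2) fun ω => by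
    rw [abs_pow]; exact pow_le_pow_left₀ (abs_nonneg _) (hyb ω) 2
  have hx3i : Integrable (fun ω => |x ω| ^ 3) μ :=
    hbd ((measurable_norm.comp hxm).pow_const 3) (D := R ^ 3) fun ω => by
      rw [abs_pow, abs_abs]; exact pow_le_pow_left₀ (abs_nonneg _) (hxb ω) 3
  have hy3i : Integrable (fun ω => |y ω| ^ 3) μ :=
    hbd ((measurable_norm.comp hym).pow_const 3) (D := R ^ 3) fun ω => by
      rw [abs_pow, abs_abs]; exact pow_le_pow_left₀ (abs_nonneg _) (hyb ω) 3
  have hx0 : ∫ ω, x ω ∂μ = 0 := by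
    simp only [hx]
    rw [integral_div, integral_sub hFi (integrable_const _)]
    simp [hu]
  have hy0 : ∫ ω, y ω ∂μ = 0 := by
    simp only [hy]
    rw [integral_div, integral_sub hGi (integrable_const _)]
    simp [hv]
  have hpt : ∀ ω, F ω ^ a * G ω ^ b ≤ u ^ a * v ^ b * (1 + a * x ω + b * y ω +
      a * b * (x ω * y ω) - a * (1 - a) / 2 * x ω ^ 2 - b * (1 - b) / 2 * y ω ^ 2
        + 10 * R ^ 3 * (|x ω| ^ 3 + |y ω| ^ 3)) := by
    intro ω
    obtain ⟨hx1, hx2, hx3⟩ := hgen (hFc ω) huc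
    obtain ⟨hy1, hy2, hy3⟩ := hgen (hGc ω) hvc
    calc F ω ^ a * G ω ^ b = (u * (1 + x ω)) ^ a * (v * (1 + y ω)) ^ b := by rw [← hx3, ← hy3]
      _ = u ^ a * v ^ b * ((1 + x ω) ^ a * (1 + y ω) ^ b) := by
        rw [Real.mul_rpow hu0.le (by linarith), Real.mul_rpow hv0.le (by linarith)]
        ring
      _ ≤ _ := mul_le_mul_of_nonneg_left
        (one_add_rpow_mul_one_add_rpow_le ha0 ha1 hb0 hb1 hx2 hy2 hR1 hx1 hy1) (by positivity)
  have hquad : a * b * ∫ ω, x ω * y ω ∂μ ≤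
      a * (1 - a) / 2 * ∫ ω, x ω ^ 2 ∂μ + b * (1 - b) / 2 * ∫ ω, y ω ^ 2 ∂μ := by
    have e1 : ∫ ω, x ω * y ω ∂μ = (u * v)⁻¹ * ∫ ω, (F ω - u) * (G ω - v) ∂μ := by
      rw [← integral_const_mul]; congr 1; ext ω; simp only [hx, hy]; field_simp
    have e2 : ∫ ω, x ω ^ 2 ∂μ = (√(∫ ω, (F ω - u) ^ 2 ∂μ) / u) ^ 2 := by
      rw [div_pow, Real.sq_sqrt (by positivity), ← integral_div]; congr 1; ext ω
      simp only [hx]; rw [div_pow]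
    have e3 : ∫ ω, y ω ^ 2 ∂μ = (√(∫ ω, (G ω - v) ^ 2 ∂μ) / v) ^ 2 := by
      rw [div_pow, Real.sq_sqrt (by positivity), ← integral_div]; congr 1; ext ω
      simp only [hy]; rw [div_pow]
    rw [e1, e2, e3]
    refine le_trans ?_ (mul_mul_le_of_sq_le (κ := a * b * ρ) ?_ ?_ ?_)
    · have := mul_le_mul_of_nonneg_left hcov (by positivity : 0 ≤ a * b * (u * v)⁻¹)
      refine le_trans (le_of_eq (by ring)) (this.trans (le_of_eq ?_))
      field_simp
    · have : 0 < 1 - a := by linarith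
      positivity
    · have : 0 < 1 - b := by linarith
      positivity
    · have := mul_le_mul_of_nonneg_left hρ (by positivity : 0 ≤ a * b)
      linarith
  have hthird : ∀ {k : α → ℝ} {w : ℝ}, c ≤ w →
      Integrable (fun ω => |(k ω - w) / w| ^ 3) μ →
      ∫ ω, |(k ω - w) / w| ^ 3 ∂μ ≤ (∫ ω, |k ω - w| ^ 3 ∂μ) / c ^ 3 := by
    intro k w hw hk
    have hw0 : 0 < w := hc.trans_le hw
    have : ∀ ω, |(k ω - w) / w| ^ 3 = |k ω - w| ^ 3 / w ^ 3 := fun ω => by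
      rw [abs_div, abs_of_pos hw0, div_pow]
    simp_rw [this]
    rw [integral_div]
    exact div_le_div_of_nonneg_left (integral_nonneg fun ω => by positivity) (by positivity)
      (pow_le_pow_left₀ hc.le hw 3)
  have i1 := ((((((integrable_const (1 : ℝ)).add (hxi.const_mul a)).add (hyi.const_mul b)).add
    (hxyi.const_mul (a * b))).sub (hx2i.const_mul (a * (1 - a) / 2))).sub
    (hy2i.const_mul (b * (1 - b) / 2))).add ((hx3i.add hy3i).const_mul (10 * R ^ 3))
  have hFG : Integrable (fun ω => F ω ^ a * G ω ^ b) μ :=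
    hbd ((hF.pow_const a).mul (hG.pow_const b)) (D := C ^ a * C ^ b) fun ω => by
      have h1 := hc.trans_le (hFc ω).1
      have h2 := hc.trans_le (hGc ω).1
      rw [abs_of_nonneg (by positivity)]
      exact mul_le_mul (Real.rpow_le_rpow h1.le (hFc ω).2 ha0.le)
        (Real.rpow_le_rpow h2.le (hGc ω).2 hb0.le) (by positivity) (by positivity)
  have hint := integral_mono hFG (i1.const_mul (u ^ a * v ^ b)) hpt
  refine hint.trans ?_
  have hval : ∫ ω, (1 + a * x ω + b * y ω + a * b * (x ω * y ω) - a * (1 - a) / 2 * x ω ^ 2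
      - b * (1 - b) / 2 * y ω ^ 2 + 10 * R ^ 3 * (|x ω| ^ 3 + |y ω| ^ 3)) ∂μ
      = 1 + a * b * ∫ ω, x ω * y ω ∂μ - a * (1 - a) / 2 * ∫ ω, x ω ^ 2 ∂μ
        - b * (1 - b) / 2 * ∫ ω, y ω ^ 2 ∂μ
        + 10 * R ^ 3 * (∫ ω, |x ω| ^ 3 ∂μ + ∫ ω, |y ω| ^ 3 ∂μ) := by
    rw [integral_add, integral_sub, integral_sub, integral_add, integral_add, integral_add,
      integral_const_mul, integral_const_mul, integral_const_mul, integral_const_mul,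
      integral_const_mul, integral_const_mul, integral_add, hx0, hy0]
    · simp
    all_goals fun_prop
  rw [integral_const_mul]
  refine le_trans (mul_le_mul_of_nonneg_left (hval.le.trans (?_ : _ ≤ 1 + 10 * R ^ 3 / c ^ 3 *
    (∫ ω, |F ω - u| ^ 3 ∂μ + ∫ ω, |G ω - v| ^ 3 ∂μ))) (by positivity)) ?_
  · have h1 := hthird huc.1 hx3i
    have h2 := hthird hvc.1 hy3i
    have h3 := mul_le_mul_of_nonneg_left (add_le_add h1 h2) (by positivity : 0 ≤ 10 * R ^ 3)
    calc _ ≤ 1 + 10 * R ^ 3 * (∫ ω, |x ω| ^ 3 ∂μ + ∫ ω, |y ω| ^ 3 ∂μ) := by linarith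
      _ ≤ _ := by refine add_le_add le_rfl (h3.trans (le_of_eq ?_)); ring
  · rw [mul_add, mul_one, ← mul_assoc]
    have h3 : 0 ≤ ∫ ω, |F ω - u| ^ 3 ∂μ + ∫ ω, |G ω - v| ^ 3 ∂μ :=
      add_nonneg (integral_nonneg fun ω => by positivity) (integral_nonneg fun ω => by positivity)
    gcongr
    · exact huc.2
    · exact hvc.2

end TwoFunctionInequality

noncomputable section HeatFlow

/-- Scaling semigroup property of a centered Gaussian measure. -/
theorem integral_sqrt_add_smul_of_isGaussian {F : Type*} [NormedAddCommGroup F] [NormedSpace ℝ F]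
    [MeasurableSpace F] [BorelSpace F] [SecondCountableTopology F] [CompleteSpace F]
    {μ : Measure F} [IsGaussian μ] (hμ : ∫ x, x ∂μ = 0) {s t : ℝ} (hs : 0 ≤ s) (ht : 0 ≤ t)
    {H : F → ℝ} (hH : Continuous H) {C : ℝ} (hC : ∀ x, |H x| ≤ C) :
    ∫ x, H (√(s + t) • x) ∂μ = ∫ x, ∫ y, H (√s • x + √t • y) ∂μ ∂μ := by
  obtain ⟨θ, h1, h2⟩ : ∃ θ, √(s + t) * Real.cos θ = √s ∧ √(s + t) * Real.sin θ = √t := by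
    have hc : ‖(⟨√s, √t⟩ : ℂ)‖ = √(s + t) := by
      rw [Complex.norm_def, Complex.normSq_mk, Real.mul_self_sqrt hs, Real.mul_self_sqrt ht]
    refine ⟨Complex.arg ⟨√s, √t⟩, ?_, ?_⟩
    · rw [← hc, Complex.norm_mul_cos_arg]
    · rw [← hc, Complex.norm_mul_sin_arg]
  have hmp : MeasurePreserving (fun z : F × F => Real.cos θ • z.1 + Real.sin θ • z.2)
      (μ.prod μ) μ :=
    measurePreserving_fst.comp
      (g := Prod.fst) (f := ContinuousLinearMap.rotation (E := F) θ)
      ⟨by fun_prop, IsGaussian.map_rotation_eq_self (by simpa using hμ) θ⟩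
  rw [← hmp.integral_comp_aestronglyMeasurable (g := fun x => H (√(s + t) • x))
    (by fun_prop : Continuous _).aestronglyMeasurable]
  simp only [smul_add, smul_smul, h1, h2]
  exact integral_prod _ (integrable_of_continuous_of_abs_le (by fun_prop) fun _ => hC _)

variable {E : Type*} [NormedAddCommGroup E] [InnerProductSpace ℝ E] [FiniteDimensional ℝ E]
  [MeasurableSpace E] [BorelSpace E]

/-- The heat semigroup `f ↦ ∫ f (x + √s • y) dγ(y)`. -/
def heatFlow (s : ℝ) (f : E → ℝ) (x : E) : ℝ := ∫ y, f (x + √s • y) ∂stdGaussian E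

theorem abs_le_of_mem_Icc {c C x : ℝ} (hc : 0 < c) (hx : x ∈ Set.Icc c C) : |x| ≤ C := by
  rw [abs_of_pos (hc.trans_le hx.1)]; exact hx.2

theorem integrable_heatFlow {f : E → ℝ} {c C : ℝ} (hc : 0 < c) (hfc : ∀ x, f x ∈ Set.Icc c C)
    (hf : Continuous f) (s : ℝ) (x : E) : Integrable (fun y => f (x + √s • y)) (stdGaussian E) :=
  integrable_of_continuous_of_abs_le (by fun_prop) fun _ => abs_le_of_mem_Icc hc (hfc _)

theorem heatFlow_mem_Icc {f : E → ℝ} {c C : ℝ} (hc : 0 < c) (hfc : ∀ x, f x ∈ Set.Icc c C)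
    (hf : Continuous f) (s : ℝ) (x : E) : heatFlow s f x ∈ Set.Icc c C := by
  have hi := integrable_heatFlow hc hfc hf s x
  constructor
  · simpa [heatFlow] using integral_mono (integrable_const c) hi fun y => (hfc _).1
  · simpa [heatFlow] using integral_mono hi (integrable_const C) fun y => (hfc _).2

theorem lipschitzWith_heatFlow {f : E → ℝ} {c C : ℝ} (hc : 0 < c) (hfc : ∀ x, f x ∈ Set.Icc c C)
    {L : NNReal} (hf : LipschitzWith L f) (s : ℝ) : LipschitzWith L (heatFlow s f) := by
  refine LipschitzWith.of_dist_le_mul fun x y => ?_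
  rw [Real.dist_eq, heatFlow, heatFlow, ← integral_sub (integrable_heatFlow hc hfc hf.continuous s x)
    (integrable_heatFlow hc hfc hf.continuous s y)]
  have := norm_integral_le_of_norm_le_const (μ := stdGaussian E)
    (f := fun z => f (x + √s • z) - f (y + √s • z)) (C := L * dist x y) (.of_forall fun z => by
      have := hf.dist_le_mul (x + √s • z) (y + √s • z)
      rwa [dist_add_right, Real.dist_eq] at this)
  simpa using this

theorem heatFlow_heatFlow {f : E → ℝ} {c C : ℝ} (hc : 0 < c) (hfc : ∀ x, f x ∈ Set.Icc c C)
    (hf : Continuous f) {s t : ℝ} (hs : 0 ≤ s) (ht : 0 ≤ t) (x : E) :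
    heatFlow s (heatFlow t f) x = heatFlow (s + t) f x := by
  rw [heatFlow, heatFlow, integral_sqrt_add_smul_of_isGaussian (H := fun y => f (x + y))
    (by simp) hs ht (by fun_prop) (C := C) fun y => abs_le_of_mem_Icc hc (hfc _)]
  simp [heatFlow, add_assoc]

theorem abs_sub_heatFlow_le {f : E → ℝ} {c C : ℝ} (hc : 0 < c) (hfc : ∀ x, f x ∈ Set.Icc c C)
    {L : NNReal} (hf : LipschitzWith L f) (s : ℝ) (x y : E) :
    |f (x + √s • y) - heatFlow s f x| ≤ L * √s * (‖y‖ + ∫ z, ‖z‖ ∂stdGaussian E) := by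
  have hn : Integrable (fun z : E => ‖z‖) (stdGaussian E) := IsGaussian.integrable_id.norm
  have h1 : f (x + √s • y) - heatFlow s f x
      = ∫ z, (f (x + √s • y) - f (x + √s • z)) ∂stdGaussian E := by
    rw [integral_sub (integrable_const _) (integrable_heatFlow hc hfc hf.continuous s x)]
    simp [heatFlow]
  rw [h1]
  refine (abs_integral_le_integral_abs).trans ?_
  have h2 : L * √s * (‖y‖ + ∫ z, ‖z‖ ∂stdGaussian E)
      = ∫ z, L * √s * (‖y‖ + ‖z‖) ∂stdGaussian E := by
    rw [integral_const_mul, integral_add (integrable_const _) hn]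
    simp
  rw [h2]
  refine integral_mono ((integrable_const _).sub
    (integrable_heatFlow hc hfc hf.continuous s x)).abs
    (((integrable_const _).add hn).const_mul _) fun z => ?_
  have := hf.dist_le_mul (x + √s • y) (x + √s • z)
  rw [dist_add_left, Real.dist_eq, dist_eq_norm, ← smul_sub, norm_smul,
    Real.norm_of_nonneg (Real.sqrt_nonneg s)] at this
  refine this.trans ?_
  rw [← mul_assoc]
  exact mul_le_mul_of_nonneg_left (norm_sub_le _ _) (by positivity)

theorem integrable_norm_add_const_pow_three (m : ℝ) :
    Integrable (fun y : E => (‖y‖ + m) ^ 3) (stdGaussian E) := by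
  have h : MemLp (fun y : E => ‖y‖ + m) 3 (stdGaussian E) :=
    (IsGaussian.memLp_id (stdGaussian E) 3 (by simp)).norm.add (memLp_const m)
  have h2 := h.integrable_norm_pow (by norm_num)
  refine (integrable_norm_iff (by fun_prop)).1 (h2.congr (.of_forall fun y => ?_))
  simp

theorem integral_abs_sub_heatFlow_pow_three_le {f : E → ℝ} {c C : ℝ} (hc : 0 < c)
    (hfc : ∀ x, f x ∈ Set.Icc c C) {L : NNReal} (hf : LipschitzWith L f) (s : ℝ) (x : E) :
    ∫ y, |f (x + √s • y) - heatFlow s f x| ^ 3 ∂stdGaussian E ≤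
      √s ^ 3 * (L ^ 3 * ∫ y, (‖y‖ + ∫ z, ‖z‖ ∂stdGaussian E) ^ 3 ∂stdGaussian E) := by
  rw [← mul_assoc, ← integral_const_mul]
  have hcf := hf.continuous
  refine integral_mono_of_nonneg (.of_forall fun y => by positivity)
    ((integrable_norm_add_const_pow_three _).const_mul _) (.of_forall fun y => ?_)
  refine (pow_le_pow_left₀ (abs_nonneg _) (abs_sub_heatFlow_le hc hfc hf s x y) 3).trans
    (le_of_eq ?_)
  simp only
  ring

end HeatFlow

noncomputable section Interpolation

variable {N : ℕ}

/-- One small step of the heat flow along a correlated Gaussian pair. -/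
theorem integral_rpow_mul_rpow_step_le {θ : ℝ} (h0 : 0 < Real.cos θ) (h1 : Real.cos θ < 1)
    {a b c C : ℝ} (ha0 : 0 < a) (ha1 : a < 1) (hb0 : 0 < b) (hb1 : b < 1)
    (hρ : Real.cos θ ^ 2 * (a * b) ≤ (1 - a) * (1 - b)) (hc : 0 < c) (L : NNReal) :
    ∃ K, 0 ≤ K ∧ ∀ f g : EuclideanSpace ℝ (Fin N) → ℝ, LipschitzWith L f → LipschitzWith L g →
      (∀ x, f x ∈ Set.Icc c C) → (∀ x, g x ∈ Set.Icc c C) →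
      ∀ (s : ℝ) (x y : EuclideanSpace ℝ (Fin N)),
      ∫ z, f (x + √s • z.1) ^ a * g (y + √s • (Real.cos θ • z.1 + Real.sin θ • z.2)) ^ b
        ∂(stdGaussian (EuclideanSpace ℝ (Fin N))).prod (stdGaussian (EuclideanSpace ℝ (Fin N)))
      ≤ heatFlow s f x ^ a * heatFlow s g y ^ b + K * √s ^ 3 := by
  set γ := stdGaussian (EuclideanSpace ℝ (Fin N)) with hγ
  set M := ∫ y : EuclideanSpace ℝ (Fin N), (‖y‖ + ∫ z, ‖z‖ ∂γ) ^ 3 ∂γ with hM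
  have hM0 : 0 ≤ M := integral_nonneg fun y => by
    have : 0 ≤ ∫ z, ‖z‖ ∂γ := integral_nonneg fun z => norm_nonneg z
    positivity
  rcases lt_or_ge C c with hcC | hcC
  · exact ⟨0, le_rfl, fun f g _ _ hf => absurd ((hf 0).1.trans (hf 0).2) (not_le.2 hcC)⟩
  have hC0 : 0 < C := hc.trans_le hcC
  refine ⟨C ^ a * C ^ b * (10 * (C / c) ^ 3 / c ^ 3) * (L ^ 3 * M + L ^ 3 * M), by positivity,
    fun f g hf hg hfc hgc s x y => ?_⟩
  have hfm := hf.continuous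
  have hgm := hg.continuous
  have hrot := measurePreserving_cos_smul_add_sin_smul_stdGaussian (E := EuclideanSpace ℝ (Fin N)) θ
  rw [← hγ] at hrot
  have hF : ∀ k : ℝ → ℝ, Continuous k → ∫ z, k (f (x + √s • z.1)) ∂γ.prod γ
      = ∫ z, k (f (x + √s • z)) ∂γ := fun k hk =>
    (measurePreserving_fst (μ := γ) (ν := γ)).integral_comp_aestronglyMeasurable
      (g := fun z => k (f (x + √s • z))) (by fun_prop : Continuous _).aestronglyMeasurable
  have hG : ∀ k : ℝ → ℝ, Continuous k →
      ∫ z, k (g (y + √s • (Real.cos θ • z.1 + Real.sin θ • z.2))) ∂γ.prod γ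
      = ∫ z, k (g (y + √s • z)) ∂γ := fun k hk =>
    hrot.integral_comp_aestronglyMeasurable
      (g := fun z => k (g (y + √s • z))) (by fun_prop : Continuous _).aestronglyMeasurable
  have hF1 : ∫ z, f (x + √s • z.1) ∂γ.prod γ = heatFlow s f x := hF id continuous_id
  have hG1 : ∫ z, g (y + √s • (Real.cos θ • z.1 + Real.sin θ • z.2)) ∂γ.prod γ
    = heatFlow s g y := hG id continuous_id
  have hbdm : ∀ {k : EuclideanSpace ℝ (Fin N) → ℝ} (_ : Continuous k)
      (_ : ∀ z, k z ∈ Set.Icc c C) (w : EuclideanSpace ℝ (Fin N)) (m : ℝ),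
      MemLp (fun z => k (w + √s • z) - m) 2 γ := fun hk hkc w m =>
    MemLp.of_bound (by fun_prop : Continuous _).aestronglyMeasurable (C + |m|) (.of_forall fun z =>
      (abs_sub _ _).trans (add_le_add_left (abs_le_of_mem_Icc hc (hkc _)) _))
  have key := integral_rpow_mul_rpow_le (μ := γ.prod γ) (F := fun z => f (x + √s • z.1))
    (G := fun z => g (y + √s • (Real.cos θ • z.1 + Real.sin θ • z.2)))
    (by fun_prop : Continuous _).measurable (by fun_prop : Continuous _).measurable
    ha0 ha1 hb0 hb1 hρ hc (fun z => hfc _) (fun z => hgc _) (by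
      rw [hF1, hG1, hF (fun r => (r - heatFlow s f x) ^ 2) (by fun_prop),
        hG (fun r => (r - heatFlow s g y) ^ 2) (by fun_prop)]
      refine integral_mul_rotate_le h0 h1 (hbdm hfm hfc x _) (hbdm hgm hgc y _) ?_
      rw [integral_sub (integrable_heatFlow hc hgc hgm s y) (integrable_const _)]
      simp [heatFlow])
  rw [hF1, hG1, hF (fun r => |r - heatFlow s f x| ^ 3) (by fun_prop),
    hG (fun r => |r - heatFlow s g y| ^ 3) (by fun_prop)] at key
  refine key.trans (add_le_add le_rfl ?_)
  rw [mul_assoc _ (_ + _) (√s ^ 3)]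
  refine mul_le_mul_of_nonneg_left ?_ (by positivity)
  have e1 := integral_abs_sub_heatFlow_pow_three_le hc hfc hf s x
  have e2 := integral_abs_sub_heatFlow_pow_three_le hc hgc hg s y
  rw [← hγ, ← hM] at e1 e2
  linarith

/-- A function with increments of order `h ^ (3/2)` from above does not increase. -/
theorem le_of_forall_step_le {Ψ : ℝ → ℝ} {K : ℝ}
    (h : ∀ s r, 0 ≤ s → 0 ≤ r → s + r ≤ 1 → Ψ (s + r) ≤ Ψ s + K * √r ^ 3) : Ψ 1 ≤ Ψ 0 := by
  have hn : ∀ n : ℕ, 0 < n → Ψ 1 ≤ Ψ 0 + K * (√(1 / n)) := by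
    intro n hn
    have hn' : (0 : ℝ) < n := by exact_mod_cast hn
    have hk : ∀ k : ℕ, k ≤ n → Ψ (k / n) ≤ Ψ 0 + k * (K * √(1 / n) ^ 3) := by
      intro k
      induction k with
      | zero => intro _; simp
      | succ k ih =>
        intro hk
        have hk' : (k : ℝ) + 1 ≤ n := by exact_mod_cast hk
        have h1 := h (k / n) (1 / n) (by positivity) (by positivity)
          (by rw [← add_div]; exact (div_le_one hn').2 hk')
        rw [← add_div] at h1
        have h2 := ih (by omega)
        push_cast
        linarith
    have := hk n le_rfl
    rw [div_self hn'.ne'] at this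
    refine this.trans (le_of_eq ?_)
    have h3 : √(1 / (n : ℝ)) ^ 2 = 1 / n := Real.sq_sqrt (by positivity)
    rw [pow_succ, h3]
    field_simp
  have hlim : Filter.Tendsto (fun n : ℕ => Ψ 0 + K * √(1 / (n : ℝ))) Filter.atTop (nhds (Ψ 0)) := by
    have h1 := (tendsto_one_div_atTop_nhds_zero_nat (𝕜 := ℝ)).sqrt
    simpa using (h1.const_mul K).const_add (Ψ 0)
  exact ge_of_tendsto hlim (Filter.eventually_atTop.2 ⟨1, fun n h => hn n h⟩)

/-- The Gaussian Hölder-type inequality for correlated vectors and nice functions. -/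
theorem integral_rpow_mul_rpow_rotate_le {θ : ℝ} (h0 : 0 < Real.cos θ) (h1 : Real.cos θ < 1)
    {a b c C : ℝ} (ha0 : 0 < a) (ha1 : a < 1) (hb0 : 0 < b) (hb1 : b < 1)
    (hρ : Real.cos θ ^ 2 * (a * b) ≤ (1 - a) * (1 - b)) (hc : 0 < c) {L : NNReal}
    {f g : EuclideanSpace ℝ (Fin N) → ℝ} (hf : LipschitzWith L f) (hg : LipschitzWith L g)
    (hfc : ∀ x, f x ∈ Set.Icc c C) (hgc : ∀ x, g x ∈ Set.Icc c C) :
    ∫ z, f z.1 ^ a * g (Real.cos θ • z.1 + Real.sin θ • z.2) ^ b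
        ∂(stdGaussian (EuclideanSpace ℝ (Fin N))).prod (stdGaussian (EuclideanSpace ℝ (Fin N)))
      ≤ (∫ x, f x ∂stdGaussian (EuclideanSpace ℝ (Fin N))) ^ a *
        (∫ x, g x ∂stdGaussian (EuclideanSpace ℝ (Fin N))) ^ b := by
  obtain ⟨K, hK0, hK⟩ := integral_rpow_mul_rpow_step_le (N := N) (C := C) h0 h1 ha0 ha1 hb0 hb1 hρ
    hc L
  set γ := stdGaussian (EuclideanSpace ℝ (Fin N)) with hγ
  set Ψ : ℝ → ℝ := fun s => ∫ z, heatFlow (1 - s) f (√s • z.1) ^ a *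
    heatFlow (1 - s) g (√s • (Real.cos θ • z.1 + Real.sin θ • z.2)) ^ b ∂γ.prod γ with hΨ
  have hC0 : 0 < C := hc.trans_le ((hfc 0).1.trans (hfc 0).2)
  have hcont : ∀ {k : EuclideanSpace ℝ (Fin N) → ℝ} (_ : LipschitzWith L k)
      (_ : ∀ x, k x ∈ Set.Icc c C) (e r : ℝ), 0 < e →
      Continuous (fun x => heatFlow r k x ^ e) := fun hk hkc e r he =>
    ((lipschitzWith_heatFlow hc hkc hk r).continuous).rpow_const fun _ => Or.inr he.le
  have hbound : ∀ {u v : ℝ}, u ∈ Set.Icc c C → v ∈ Set.Icc c C → |u ^ a * v ^ b| ≤ C ^ a * C ^ b := by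
    intro u v hu hv
    have hu0 := hc.trans_le hu.1
    have hv0 := hc.trans_le hv.1
    rw [abs_of_nonneg (by positivity)]
    exact mul_le_mul (Real.rpow_le_rpow hu0.le hu.2 ha0.le)
        (Real.rpow_le_rpow hv0.le hv.2 hb0.le) (by positivity) (by positivity)
  have hmean : ∫ z, z ∂γ.prod γ = 0 := by
    have hi : Integrable (fun z => z) (γ.prod γ) := IsGaussian.integrable_id
    refine Prod.ext ?_ ?_
    · rw [fst_integral hi, (measurePreserving_fst (μ := γ) (ν := γ)).integral_comp_aestronglyMeasurable
        (g := fun x => x) (by fun_prop)]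
      simp [hγ]
    · rw [snd_integral hi, (measurePreserving_snd (μ := γ) (ν := γ)).integral_comp_aestronglyMeasurable
        (g := fun x => x) (by fun_prop)]
      simp [hγ]
  have hmain : Ψ 1 ≤ Ψ 0 := by
    refine le_of_forall_step_le (K := K) fun s r hs hr hsr => ?_
    have hr' : 0 ≤ 1 - (s + r) := by linarith
    have e1 : ∀ (k : EuclideanSpace ℝ (Fin N) → ℝ), LipschitzWith L k →
        (∀ x, k x ∈ Set.Icc c C) → ∀ x, heatFlow (1 - s) k x
          = heatFlow r (heatFlow (1 - (s + r)) k) x := fun k hk hkc x => by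
      rw [heatFlow_heatFlow hc hkc hk.continuous hr hr']; congr 1; ring
    have hcf := hcont hf hfc a (1 - (s + r)) ha0
    have hcg := hcont hg hgc b (1 - (s + r)) hb0
    have hcf' := hcont hf hfc a (1 - s) ha0
    have hcg' := hcont hg hgc b (1 - s) hb0
    have hH : Continuous fun z : EuclideanSpace ℝ (Fin N) × EuclideanSpace ℝ (Fin N) =>
        heatFlow (1 - (s + r)) f z.1 ^ a *
          heatFlow (1 - (s + r)) g (Real.cos θ • z.1 + Real.sin θ • z.2) ^ b :=
      (hcf.comp continuous_fst).mul (hcg.comp (by fun_prop))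
    have e2 := integral_sqrt_add_smul_of_isGaussian (μ := γ.prod γ) hmean hs hr hH (C := C ^ a * C ^ b)
      fun z => hbound (heatFlow_mem_Icc hc hfc hf.continuous _ _)
        (heatFlow_mem_Icc hc hgc hg.continuous _ _)
    have e3 : Ψ (s + r) = ∫ w, ∫ z, heatFlow (1 - (s + r)) f (√s • w.1 + √r • z.1) ^ a *
        heatFlow (1 - (s + r)) g (√s • (Real.cos θ • w.1 + Real.sin θ • w.2) +
          √r • (Real.cos θ • z.1 + Real.sin θ • z.2)) ^ b ∂γ.prod γ ∂γ.prod γ := by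
      simp only [hΨ]
      convert! e2 using 1
      · congr 1; ext z
        simp only [Prod.smul_fst, Prod.smul_snd]
        congr 3
        module
      · congr 1; ext w; congr 1; ext z
        simp only [Prod.smul_fst, Prod.smul_snd, Prod.fst_add, Prod.snd_add]
        congr 3
        module
    have hi : Integrable (fun w : EuclideanSpace ℝ (Fin N) × EuclideanSpace ℝ (Fin N) =>
        heatFlow (1 - s) f (√s • w.1) ^ a *
          heatFlow (1 - s) g (√s • (Real.cos θ • w.1 + Real.sin θ • w.2)) ^ b) (γ.prod γ) :=
      integrable_of_continuous_of_abs_le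
        ((hcf'.comp (by fun_prop : Continuous fun w : EuclideanSpace ℝ (Fin N) ×
          EuclideanSpace ℝ (Fin N) => √s • w.1)).mul
          (hcg'.comp (by fun_prop : Continuous fun w : EuclideanSpace ℝ (Fin N) ×
            EuclideanSpace ℝ (Fin N) => √s • (Real.cos θ • w.1 + Real.sin θ • w.2))))
        fun z => hbound (heatFlow_mem_Icc hc hfc hf.continuous _ _)
          (heatFlow_mem_Icc hc hgc hg.continuous _ _)
    have e4 : Ψ s + K * √r ^ 3 = ∫ w, (heatFlow (1 - s) f (√s • w.1) ^ a *
        heatFlow (1 - s) g (√s • (Real.cos θ • w.1 + Real.sin θ • w.2)) ^ b + K * √r ^ 3)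
          ∂γ.prod γ := by
      rw [integral_add hi (integrable_const _)]
      simp [hΨ]
    rw [e3, e4]
    refine integral_mono_of_nonneg (.of_forall fun w => integral_nonneg fun z => ?_)
      (hi.add (integrable_const _))
      (.of_forall fun w => ?_)
    · have h3 := (heatFlow_mem_Icc hc hfc hf.continuous (1 - (s + r)) (√s • w.1 + √r • z.1)).1
      have h4 := (heatFlow_mem_Icc hc hgc hg.continuous (1 - (s + r))
        (√s • (Real.cos θ • w.1 + Real.sin θ • w.2) +
          √r • (Real.cos θ • z.1 + Real.sin θ • z.2))).1
      exact mul_nonneg (Real.rpow_nonneg (hc.le.trans h3) _) (Real.rpow_nonneg (hc.le.trans h4) _)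
    · simp only
      rw [e1 f hf hfc, e1 g hg hgc]
      exact hK _ _ (lipschitzWith_heatFlow hc hfc hf _) (lipschitzWith_heatFlow hc hgc hg _)
        (heatFlow_mem_Icc hc hfc hf.continuous _) (heatFlow_mem_Icc hc hgc hg.continuous _) _ _ _
  simpa [hΨ, heatFlow] using hmain

end Interpolation

section LipschitzHypercontractivity

theorem lipschitzOnWith_rpow_Icc {p M : ℝ} (hp : 1 ≤ p) :
    LipschitzOnWith (p * M ^ (p - 1)).toNNReal (fun x : ℝ => x ^ p) (Set.Icc 0 M) := by
  refine (convex_Icc 0 M).lipschitzOnWith_of_nnnorm_hasDerivWithin_le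
    (fun x hx => (Real.hasDerivAt_rpow_const (Or.inr hp)).hasDerivWithinAt) fun x hx => ?_
  have h1 : 0 ≤ p * x ^ (p - 1) := mul_nonneg (by linarith) (Real.rpow_nonneg hx.1 _)
  rw [← norm_toNNReal, Real.norm_of_nonneg h1]
  exact Real.toNNReal_le_toNNReal (mul_le_mul_of_nonneg_left
    (Real.rpow_le_rpow hx.1 hx.2 (by linarith)) (by linarith))

theorem lipschitzWith_abs_add_rpow {E : Type*} [PseudoMetricSpace E] {φ : E → ℝ} {L : NNReal}
    (hφ : LipschitzWith L φ) {M : ℝ} (hM : ∀ x, |φ x| ≤ M) {p δ : ℝ} (hp : 1 ≤ p) (hδ : 0 ≤ δ) :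
    ∃ L', LipschitzWith L' fun x => (|φ x| + δ) ^ p := by
  have h1 : LipschitzWith L fun x => |φ x| + δ := by
    refine LipschitzWith.of_dist_le_mul fun x y => ?_
    rw [dist_add_right]
    refine le_trans ?_ (hφ.dist_le_mul x y)
    rw [Real.dist_eq, Real.dist_eq]
    exact abs_abs_sub_abs_le _ _
  refine ⟨_, lipschitzOnWith_univ.1 ((lipschitzOnWith_rpow_Icc (M := M + δ) hp).comp
    (lipschitzOnWith_univ.2 h1) fun x _ => ⟨by positivity, by linarith [hM x]⟩)⟩

theorem eLpNorm_toReal_eq {α : Type*} [MeasurableSpace α] {μ : Measure α} {f : α → ℝ} {p : ℝ}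
    (hp : 0 < p) (hf : MemLp f (ENNReal.ofReal p) μ) :
    (eLpNorm f (ENNReal.ofReal p) μ).toReal = (∫ x, |f x| ^ p ∂μ) ^ (1 / p) := by
  rw [hf.eLpNorm_eq_integral_rpow_norm (by simpa using hp) (by simp), ENNReal.toReal_ofReal,
    ENNReal.toReal_ofReal hp.le, one_div]
  · rfl
  · positivity

variable {N : ℕ}

theorem abs_integral_mul_rotate_le_of_lipschitz {θ : ℝ} (h0 : 0 < Real.cos θ)
    (h1 : Real.cos θ < 1) {p r : ℝ} (hp : 1 < p) (hr : 1 < r)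
    (hpr : Real.cos θ ^ 2 ≤ (p - 1) * (r - 1)) {L : NNReal} {M : ℝ}
    {φ ψ : EuclideanSpace ℝ (Fin N) → ℝ} (hφ : LipschitzWith L φ) (hψ : LipschitzWith L ψ)
    (hφM : ∀ x, |φ x| ≤ M) (hψM : ∀ x, |ψ x| ≤ M) :
    |∫ z, φ z.1 * ψ (Real.cos θ • z.1 + Real.sin θ • z.2)
        ∂(stdGaussian (EuclideanSpace ℝ (Fin N))).prod (stdGaussian (EuclideanSpace ℝ (Fin N)))|
      ≤ (eLpNorm φ (ENNReal.ofReal p) (stdGaussian (EuclideanSpace ℝ (Fin N)))).toReal *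
        (eLpNorm ψ (ENNReal.ofReal r) (stdGaussian (EuclideanSpace ℝ (Fin N)))).toReal := by
  set γ := stdGaussian (EuclideanSpace ℝ (Fin N)) with hγ
  have hp0 : 0 < p := by linarith
  have hr0 : 0 < r := by linarith
  have hM0 : 0 ≤ M := (abs_nonneg _).trans (hφM 0)
  have hφc := hφ.continuous
  have hψc := hψ.continuous
  have hmem : ∀ {k : EuclideanSpace ℝ (Fin N) → ℝ} (_ : Continuous k) (_ : ∀ x, |k x| ≤ M)
      (e : ℝ≥0∞), MemLp k e γ := fun hk hkM e =>
    MemLp.of_bound hk.measurable.aestronglyMeasurable M (.of_forall hkM)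
  have hminkowski : ∀ {k : EuclideanSpace ℝ (Fin N) → ℝ} (_ : Continuous k)
      (_ : ∀ x, |k x| ≤ M) {e δ : ℝ} (_ : 1 < e) (_ : 0 < δ),
      (∫ x, (|k x| + δ) ^ e ∂γ) ^ (1 / e) ≤ (eLpNorm k (ENNReal.ofReal e) γ).toReal + δ := by
    intro k hk hkM e δ he hδ
    have m1 : MemLp (fun x => |k x|) (ENNReal.ofReal e) γ := (hmem hk hkM _).abs
    have m2 : MemLp (fun _ : EuclideanSpace ℝ (Fin N) => δ) (ENNReal.ofReal e) γ := memLp_const δ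
    have m3 : MemLp (fun x => |k x| + δ) (ENNReal.ofReal e) γ := m1.add m2
    have h2 := eLpNorm_toReal_eq (by linarith) m3
    have h3 : ∀ x, |(|k x| + δ)| = |k x| + δ := fun x => abs_of_nonneg (by positivity)
    simp_rw [h3] at h2
    rw [← h2]
    have h4 := eLpNorm_add_le m1.1 m2.1 (p := ENNReal.ofReal e) (by
      rw [← ENNReal.ofReal_one]; exact ENNReal.ofReal_le_ofReal he.le)
    have h5 := ENNReal.toReal_mono (by finiteness [m1.eLpNorm_ne_top, m2.eLpNorm_ne_top]) h4
    rw [ENNReal.toReal_add m1.eLpNorm_ne_top m2.eLpNorm_ne_top,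
      eLpNorm_const _ (by simpa using by linarith)
        (by rw [hγ]; exact IsProbabilityMeasure.ne_zero _)] at h5
    refine h5.trans (le_of_eq ?_)
    congr 1
    · congr 1
      exact eLpNorm_norm k
    · simp [abs_of_pos hδ]
  have hδ : ∀ δ : ℝ, 0 < δ → |∫ z, φ z.1 * ψ (Real.cos θ • z.1 + Real.sin θ • z.2) ∂γ.prod γ| ≤
      ((eLpNorm φ (ENNReal.ofReal p) γ).toReal + δ) *
        ((eLpNorm ψ (ENNReal.ofReal r) γ).toReal + δ) := by
    intro δ hδ
    obtain ⟨L1, hL1⟩ := lipschitzWith_abs_add_rpow hφ hφM hp.le hδ.le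
    obtain ⟨L2, hL2⟩ := lipschitzWith_abs_add_rpow hψ hψM hr.le hδ.le
    set c := min (δ ^ p) (δ ^ r) with hc
    set C := max ((M + δ) ^ p) ((M + δ) ^ r) with hC
    have hc0 : 0 < c := lt_min (by positivity) (by positivity)
    have key := integral_rpow_mul_rpow_rotate_le (N := N) h0 h1 (a := 1 / p) (b := 1 / r) (c := c)
      (C := C) (by positivity) ((div_lt_one hp0).2 hp) (by positivity) ((div_lt_one hr0).2 hr)
      (by
        have : (1 - 1 / p) * (1 - 1 / r) = (p - 1) * (r - 1) * (1 / p * (1 / r)) := by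
          field_simp
        rw [this]
        exact mul_le_mul_of_nonneg_right hpr (by positivity)) hc0
      (hL1.weaken (le_max_left L1 L2)) (hL2.weaken (le_max_right L1 L2))
      (fun x => ⟨(min_le_left _ _).trans (Real.rpow_le_rpow hδ.le (by linarith [abs_nonneg (φ x)])
        hp0.le), le_max_of_le_left (Real.rpow_le_rpow (by positivity) (by linarith [hφM x]) hp0.le)⟩)
      (fun x => ⟨(min_le_right _ _).trans (Real.rpow_le_rpow hδ.le (by linarith [abs_nonneg (ψ x)])
        hr0.le), le_max_of_le_right (Real.rpow_le_rpow (by positivity) (by linarith [hψM x]) hr0.le)⟩)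
    have hinv : ∀ {e y : ℝ}, 0 < e → 0 ≤ y → (y ^ e) ^ (1 / e) = y := fun he hy => by
      rw [← Real.rpow_mul hy, mul_one_div_cancel he.ne', Real.rpow_one]
    have e1 : ∀ z : EuclideanSpace ℝ (Fin N) × EuclideanSpace ℝ (Fin N),
        ((|φ z.1| + δ) ^ p) ^ (1 / p) *
          ((|ψ (Real.cos θ • z.1 + Real.sin θ • z.2)| + δ) ^ r) ^ (1 / r)
        = (|φ z.1| + δ) * (|ψ (Real.cos θ • z.1 + Real.sin θ • z.2)| + δ) := fun z => by
      rw [hinv hp0 (by positivity), hinv hr0 (by positivity)]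
    simp_rw [e1] at key
    refine le_trans ?_ (key.trans (mul_le_mul (hminkowski hφc hφM hp hδ)
      (hminkowski hψc hψM hr hδ) (by positivity) (by positivity)))
    refine abs_integral_le_integral_abs.trans ?_
    refine integral_mono_of_nonneg (.of_forall fun z => abs_nonneg _)
      (integrable_of_continuous_of_abs_le (by fun_prop) (C := (M + δ) * (M + δ)) fun z => ?_)
      (.of_forall fun z => ?_)
    · rw [abs_of_nonneg (by positivity)]
      exact mul_le_mul (add_le_add_left (hφM z.1) δ) (add_le_add_left (hψM _) δ)
        (by positivity) (by positivity)
    · simp only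
      rw [abs_mul]
      exact mul_le_mul (by linarith) (by linarith) (abs_nonneg _) (by positivity)
  have hlim : Filter.Tendsto (fun δ : ℝ => ((eLpNorm φ (ENNReal.ofReal p) γ).toReal + δ) *
        ((eLpNorm ψ (ENNReal.ofReal r) γ).toReal + δ)) (nhdsWithin 0 (Set.Ioi 0))
      (nhds (((eLpNorm φ (ENNReal.ofReal p) γ).toReal + 0) *
        ((eLpNorm ψ (ENNReal.ofReal r) γ).toReal + 0))) :=
    ((by fun_prop : Continuous fun δ : ℝ => ((eLpNorm φ (ENNReal.ofReal p) γ).toReal + δ) *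
        ((eLpNorm ψ (ENNReal.ofReal r) γ).toReal + δ)).tendsto 0).mono_left nhdsWithin_le_nhds
  rw [add_zero, add_zero] at hlim
  exact ge_of_tendsto hlim (by filter_upwards [self_mem_nhdsWithin] with δ hd using hδ δ hd)

/-- Smooth compactly supported approximation in `L²` and `L^p` simultaneously. -/
theorem exists_lipschitz_approx {p : ℝ} (hp : 1 < p)
    {f : Lp ℝ 2 (stdGaussian (EuclideanSpace ℝ (Fin N)))}
    (hf : MemLp f (ENNReal.ofReal p) (stdGaussian (EuclideanSpace ℝ (Fin N)))) {ε : ℝ}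
    (hε : 0 < ε) :
    ∃ (φ : EuclideanSpace ℝ (Fin N) → ℝ) (φ' : Lp ℝ 2 (stdGaussian (EuclideanSpace ℝ (Fin N))))
      (L : NNReal) (M : ℝ), φ' =ᵐ[stdGaussian (EuclideanSpace ℝ (Fin N))] φ ∧
      LipschitzWith L φ ∧ (∀ x, |φ x| ≤ M) ∧ ‖f - φ'‖ ≤ ε ∧
      (eLpNorm φ (ENNReal.ofReal p) (stdGaussian (EuclideanSpace ℝ (Fin N)))).toReal ≤
      (eLpNorm f (ENNReal.ofReal p) (stdGaussian (EuclideanSpace ℝ (Fin N)))).toReal + ε := by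
  have hp1 : 1 ≤ ENNReal.ofReal p := by
    rw [← ENNReal.ofReal_one]; exact ENNReal.ofReal_le_ofReal hp.le
  set e := max (ENNReal.ofReal p) 2 with he
  have he1 : 1 ≤ e := hp1.trans (le_max_left _ _)
  have hfe : MemLp f e (stdGaussian (EuclideanSpace ℝ (Fin N))) := by
    rcases le_total (ENNReal.ofReal p) 2 with h | h
    · rw [he, max_eq_right h]; exact Lp.memLp f
    · rw [he, max_eq_left h]; exact hf
  obtain ⟨φ, hφs, hφd, hφe⟩ := MemLp.exist_eLpNorm_sub_le (by simp [he]) he1 hfe hε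
  obtain ⟨M, hM⟩ := hφd.continuous.bounded_above_of_compact_support hφs
  obtain ⟨L, hL⟩ := hφd.lipschitzWith_of_hasCompactSupport hφs (by simp)
  have hm : ∀ e', MemLp φ e' (stdGaussian (EuclideanSpace ℝ (Fin N))) := fun e' =>
    MemLp.of_bound hφd.continuous.measurable.aestronglyMeasurable M (.of_forall hM)
  have hsub : AEStronglyMeasurable (f - φ : EuclideanSpace ℝ (Fin N) → ℝ) (stdGaussian (EuclideanSpace ℝ (Fin N))) := (Lp.aestronglyMeasurable f).sub (hm 1).1
  refine ⟨φ, (hm 2).toLp, L, M, (hm 2).coeFn_toLp, hL, hM, ?_, ?_⟩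
  · rw [Lp.norm_def]
    refine ENNReal.toReal_le_of_le_ofReal hε.le ?_
    rw [eLpNorm_congr_ae ((Lp.coeFn_sub _ _).trans
      ((ae_eq_refl _).sub (hm 2).coeFn_toLp))]
    exact (eLpNorm_le_eLpNorm_of_exponent_le (le_max_right _ _) hsub).trans hφe
  · have h1 : eLpNorm φ (ENNReal.ofReal p) (stdGaussian (EuclideanSpace ℝ (Fin N)))
        ≤ eLpNorm f (ENNReal.ofReal p) (stdGaussian (EuclideanSpace ℝ (Fin N))) + ENNReal.ofReal ε := by
      have h2 := eLpNorm_sub_le hf.1 hsub hp1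
      rw [sub_sub_cancel] at h2
      exact h2.trans (add_le_add_right ((eLpNorm_le_eLpNorm_of_exponent_le
        (le_max_left _ _) hsub).trans hφe) _)
    have h3 := ENNReal.toReal_mono (by finiteness [hf.eLpNorm_ne_top]) h1
    rwa [ENNReal.toReal_add hf.eLpNorm_ne_top (by simp), ENNReal.toReal_ofReal hε.le] at h3

/-- Hypercontractivity in bilinear form. -/
theorem abs_inner_mehler_le {θ : ℝ} (h0 : 0 < Real.cos θ) (h1 : Real.cos θ < 1) {p r : ℝ}
    (hp : 1 < p) (hr : 1 < r) (hpr : Real.cos θ ^ 2 ≤ (p - 1) * (r - 1))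
    {f g : Lp ℝ 2 (stdGaussian (EuclideanSpace ℝ (Fin N)))}
    (hf : MemLp f (ENNReal.ofReal p) (stdGaussian (EuclideanSpace ℝ (Fin N))))
    (hg : MemLp g (ENNReal.ofReal r) (stdGaussian (EuclideanSpace ℝ (Fin N)))) :
    |inner ℝ f (mehler _ θ g)| ≤
      (eLpNorm f (ENNReal.ofReal p) (stdGaussian (EuclideanSpace ℝ (Fin N)))).toReal *
      (eLpNorm g (ENNReal.ofReal r) (stdGaussian (EuclideanSpace ℝ (Fin N)))).toReal := by
  have hpos : ∀ n : ℕ, (0 : ℝ) < 1 / (n + 1) := fun n => Nat.one_div_pos_of_nat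
  choose φ φ' L M hφ hL hM hφn hφp using fun n : ℕ => exists_lipschitz_approx hp hf (hpos n)
  choose ψ ψ' L' M' hψ hL' hM' hψn hψp using fun n : ℕ => exists_lipschitz_approx hr hg (hpos n)
  have hlim := tendsto_one_div_add_atTop_nhds_zero_nat (𝕜 := ℝ)
  have hconv : ∀ {k : Lp ℝ 2 (stdGaussian (EuclideanSpace ℝ (Fin N)))} {k' : ℕ → Lp ℝ 2 (stdGaussian (EuclideanSpace ℝ (Fin N)))}, (∀ n : ℕ, ‖k - k' n‖ ≤ 1 / ((n : ℝ) + 1)) →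
      Filter.Tendsto k' Filter.atTop (nhds k) := by
    intro k k' hk
    rw [tendsto_iff_norm_sub_tendsto_zero]
    refine squeeze_zero (fun _ => norm_nonneg _) (fun n => ?_) hlim
    rw [norm_sub_rev]; exact hk n
  have hl := ((hconv hφn).inner (𝕜 := ℝ) (((mehler _ θ).continuous.tendsto g).comp
    (hconv hψn))).abs
  have hrr := (hlim.const_add (eLpNorm f (ENNReal.ofReal p) (stdGaussian (EuclideanSpace ℝ (Fin N)))).toReal).mul
    (hlim.const_add (eLpNorm g (ENNReal.ofReal r) (stdGaussian (EuclideanSpace ℝ (Fin N)))).toReal)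
  rw [add_zero, add_zero] at hrr
  refine le_of_tendsto_of_tendsto' hl hrr fun n => ?_
  refine le_trans ?_ (mul_le_mul (hφp n) (hψp n) ENNReal.toReal_nonneg
    (add_nonneg ENNReal.toReal_nonneg (hpos n).le))
  refine le_trans (le_of_eq ?_) (abs_integral_mul_rotate_le_of_lipschitz h0 h1 hp hr hpr
    ((hL n).weaken (le_max_left (L n) (L' n))) ((hL' n).weaken (le_max_right (L n) (L' n)))
    (fun x => (hM n x).trans (le_max_left (M n) (M' n)))
    (fun x => (hM' n x).trans (le_max_right (M n) (M' n))))
  rw [Function.comp_apply, inner_mehler_right]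
  congr 1
  refine integral_congr_ae ?_
  filter_upwards [(measurePreserving_fst (μ := (stdGaussian (EuclideanSpace ℝ (Fin N)))) (ν := (stdGaussian (EuclideanSpace ℝ (Fin N))))).quasiMeasurePreserving.ae_eq_comp
      (hφ n), (measurePreserving_cos_smul_add_sin_smul_stdGaussian
        θ).quasiMeasurePreserving.ae_eq_comp (hψ n)] with z h1 h2
  simp only [Function.comp_apply] at h1 h2
  rw [h1, h2]

end LipschitzHypercontractivity

section Duality

/-- The `L^q` norm is determined by testing against bounded functions. -/
theorem eLpNorm_le_of_forall_abs_integral_mul_le {α : Type*} [MeasurableSpace α] {μ : Measure α}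
    [IsFiniteMeasure μ] {h : α → ℝ} (hm : Measurable h) (hi : Integrable h μ) {q r : ℝ}
    (hqr : q.HolderConjugate r) {K : ℝ} (hK : 0 ≤ K)
    (H : ∀ φ : α → ℝ, Measurable φ → (∃ M, ∀ x, |φ x| ≤ M) →
      |∫ x, φ x * h x ∂μ| ≤ K * (eLpNorm φ (ENNReal.ofReal r) μ).toReal) :
    eLpNorm h (ENNReal.ofReal q) μ ≤ ENNReal.ofReal K := by
  have hq0 : 0 < q := hqr.pos
  have hr0 : 0 < r := hqr.symm.pos
  have hq1 : 1 < q := hqr.lt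
  set m : ℕ → α → ℝ := fun n x => min |h x| n with hmdef
  have hmm : ∀ n, Measurable (m n) := fun n => by fun_prop
  have hm0 : ∀ n x, 0 ≤ m n x := fun n x => le_min (abs_nonneg _) (Nat.cast_nonneg n)
  have hmn : ∀ n x, m n x ≤ n := fun n x => min_le_right _ _
  have hbd : ∀ {k : α → ℝ} {D : ℝ} {e : ℝ≥0∞}, Measurable k → (∀ x, |k x| ≤ D) → MemLp k e μ :=
    fun hk hD => MemLp.of_bound hk.aestronglyMeasurable _ (.of_forall hD)
  have hstep : ∀ n, eLpNorm (m n) (ENNReal.ofReal q) μ ≤ ENNReal.ofReal K := by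
    intro n
    have hmem : MemLp (m n) (ENNReal.ofReal q) μ := hbd (hmm n) (D := n) fun x => by
      rw [abs_of_nonneg (hm0 n x)]; exact hmn n x
    set I := ∫ x, m n x ^ q ∂μ with hI
    have hI0 : 0 ≤ I := integral_nonneg fun x => Real.rpow_nonneg (hm0 n x) _
    set φ : α → ℝ := fun x => (if 0 ≤ h x then 1 else -1) * m n x ^ (q - 1) with hφ
    have hφm : Measurable φ :=
      (Measurable.ite (measurableSet_le measurable_const hm) measurable_const
        measurable_const).mul ((hmm n).pow_const _)
    have hφa : ∀ x, |φ x| = m n x ^ (q - 1) := fun x => by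
      have := Real.rpow_nonneg (hm0 n x) (q - 1)
      simp only [hφ]
      split_ifs <;> simp [abs_of_nonneg this]
    have hφb : ∀ x, |φ x| ≤ (n : ℝ) ^ (q - 1) := fun x => by
      rw [hφa]; exact Real.rpow_le_rpow (hm0 n x) (hmn n x) (by linarith)
    have hφh : ∀ x, m n x ^ q ≤ φ x * h x := fun x => by
      have e1 : φ x * h x = m n x ^ (q - 1) * |h x| := by
        simp only [hφ]
        split_ifs with hx
        · rw [abs_of_nonneg hx]; ring
        · rw [abs_of_neg (not_le.1 hx)]; ring
      have e2 : m n x ^ q = m n x ^ (q - 1) * m n x := by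
        rw [← Real.rpow_add_one' (hm0 n x) (by linarith)]; congr 1; ring
      rw [e1, e2]
      exact mul_le_mul_of_nonneg_left (min_le_left _ _) (Real.rpow_nonneg (hm0 n x) _)
    have hφn : (eLpNorm φ (ENNReal.ofReal r) μ).toReal = I ^ (1 / r) := by
      rw [eLpNorm_toReal_eq hr0 (hbd hφm hφb)]
      congr 2
      ext x
      rw [hφa, ← Real.rpow_mul (hm0 n x), hqr.sub_one_mul_conj]
    have hle : I ≤ K * I ^ (1 / r) := by
      rw [← hφn]
      refine le_trans ?_ ((le_abs_self _).trans (H φ hφm ⟨_, hφb⟩))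
      refine integral_mono_of_nonneg (.of_forall fun x => Real.rpow_nonneg (hm0 n x) _)
        (hi.bdd_mul hφm.aestronglyMeasurable (.of_forall hφb)) (.of_forall hφh)
    have hle2 : I ^ (1 / q) ≤ K := by
      rcases hI0.eq_or_lt with h0 | h0
      · rw [← h0, Real.zero_rpow (by positivity)]; exact hK
      · have e3 : I = I ^ (1 / q) * I ^ (1 / r) := by
          rw [← Real.rpow_add h0, one_div, one_div, hqr.inv_add_inv_eq_one, Real.rpow_one]
        exact le_of_mul_le_mul_right (e3.symm.le.trans hle) (Real.rpow_pos_of_pos h0 _)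
    rw [← ENNReal.ofReal_toReal hmem.eLpNorm_ne_top, eLpNorm_toReal_eq hq0 hmem]
    refine ENNReal.ofReal_le_ofReal (le_trans (le_of_eq ?_) hle2)
    congr 2
    ext x
    rw [abs_of_nonneg (hm0 n x)]
  have hlim : ∀ x, Filter.Tendsto (fun n => m n x) Filter.atTop (nhds |h x|) := fun x => by
    obtain ⟨n0, hn0⟩ := exists_nat_ge |h x|
    refine tendsto_const_nhds.congr' (Filter.eventually_atTop.2 ⟨n0, fun n hn => ?_⟩)
    exact (min_eq_left (hn0.trans (by exact_mod_cast hn))).symm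
  have hf := Lp.eLpNorm_lim_le_liminf_eLpNorm (p := ENNReal.ofReal q)
    (fun n => (hmm n).aestronglyMeasurable (μ := μ)) (fun x => |h x|) (.of_forall hlim)
  have hnorm : eLpNorm (fun x => |h x|) (ENNReal.ofReal q) μ = eLpNorm h (ENNReal.ofReal q) μ :=
    eLpNorm_norm h
  rw [← hnorm]
  refine hf.trans (Filter.liminf_le_of_frequently_le' (Filter.Frequently.of_forall hstep))

end Duality

section L2Bounds

variable {Ω : Type*} [MeasurableSpace Ω] {P : Measure Ω} {N : ℕ} {X : Fin N → Ω → ℝ}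
  {Y : Ω → EuclideanSpace ℝ (Fin N)}

theorem eLpNorm_adjoint_compMeasurePreserving_le
    (hY : MeasurePreserving Y P (stdGaussian (EuclideanSpace ℝ (Fin N)))) {p : ℝ} (hp : 1 < p)
    {F : Lp ℝ 2 P} (hF : MemLp F (ENNReal.ofReal p) P) :
    eLpNorm (ContinuousLinearMap.adjoint
        (Lp.compMeasurePreservingₗᵢ ℝ Y hY).toContinuousLinearMap F :
          Lp ℝ 2 (stdGaussian (EuclideanSpace ℝ (Fin N)))) (ENNReal.ofReal p)
        (stdGaussian (EuclideanSpace ℝ (Fin N))) ≤ eLpNorm F (ENNReal.ofReal p) P := by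
  have hpr := Real.HolderConjugate.conjExponent hp
  rw [← ENNReal.ofReal_toReal hF.eLpNorm_ne_top]
  refine eLpNorm_le_of_forall_abs_integral_mul_le (Lp.stronglyMeasurable _).measurable
    ((Lp.memLp _).integrable (by norm_num)) hpr ENNReal.toReal_nonneg fun φ hφ ⟨M, hM⟩ => ?_
  have hmem : ∀ e, MemLp φ e (stdGaussian (EuclideanSpace ℝ (Fin N))) := fun e =>
    MemLp.of_bound hφ.aestronglyMeasurable M (.of_forall hM)
  obtain ⟨φ', hφ'⟩ : ∃ φ' : Lp ℝ 2 (stdGaussian (EuclideanSpace ℝ (Fin N))),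
      φ' =ᵐ[stdGaussian (EuclideanSpace ℝ (Fin N))] φ := ⟨(hmem 2).toLp, (hmem 2).coeFn_toLp⟩
  have e1 : ∫ x, φ x * (ContinuousLinearMap.adjoint
      (Lp.compMeasurePreservingₗᵢ ℝ Y hY).toContinuousLinearMap F :
        Lp ℝ 2 (stdGaussian (EuclideanSpace ℝ (Fin N)))) x
        ∂stdGaussian (EuclideanSpace ℝ (Fin N)) = ∫ ω, φ (Y ω) * F ω ∂P := by
    calc _ = inner ℝ φ' (ContinuousLinearMap.adjoint
        (Lp.compMeasurePreservingₗᵢ ℝ Y hY).toContinuousLinearMap F) := by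
          rw [L2.inner_def]
          refine integral_congr_ae ?_
          filter_upwards [hφ'] with x hx
          rw [RCLike.inner_apply, conj_trivial, mul_comm, hx]
      _ = inner ℝ (Lp.compMeasurePreservingₗᵢ ℝ Y hY φ') F := by
          rw [ContinuousLinearMap.adjoint_inner_right]; rfl
      _ = _ := by
          rw [L2.inner_def]
          refine integral_congr_ae ?_
          filter_upwards [coeFn_compMeasurePreservingₗᵢ hY hφ'] with x hx
          rw [RCLike.inner_apply, conj_trivial, mul_comm, hx]
  have hcomp : MemLp (fun ω => φ (Y ω)) (ENNReal.ofReal p.conjExponent) P :=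
    (hmem _).comp_measurePreserving hY
  have e2 : eLpNorm (fun ω => φ (Y ω)) (ENNReal.ofReal p.conjExponent) P
      = eLpNorm φ (ENNReal.ofReal p.conjExponent) (stdGaussian (EuclideanSpace ℝ (Fin N))) :=
    eLpNorm_comp_measurePreserving hφ.aestronglyMeasurable hY
  rw [e1, ← e2, eLpNorm_toReal_eq hpr.pos hF, eLpNorm_toReal_eq hpr.symm.pos hcomp, mul_comm]
  refine abs_integral_le_integral_abs.trans ?_
  simp_rw [abs_mul]
  exact integral_mul_norm_le_Lp_mul_Lq hpr.symm hcomp hF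

/-- Hypercontractivity of the Mehler operator on `L² ∩ L^p`. -/
theorem eLpNorm_mehler_le {θ : ℝ} (h0 : 0 < Real.cos θ) (h1 : Real.cos θ < 1) {p q : ℝ}
    (hp : 1 < p) (hq : 1 < q) (hpq : Real.cos θ ^ 2 * (q - 1) ≤ p - 1)
    {f : Lp ℝ 2 (stdGaussian (EuclideanSpace ℝ (Fin N)))}
    (hf : MemLp f (ENNReal.ofReal p) (stdGaussian (EuclideanSpace ℝ (Fin N)))) :
    eLpNorm (mehler _ θ f) (ENNReal.ofReal q) (stdGaussian (EuclideanSpace ℝ (Fin N))) ≤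
      eLpNorm f (ENNReal.ofReal p) (stdGaussian (EuclideanSpace ℝ (Fin N))) := by
  have hqr := Real.HolderConjugate.conjExponent hq
  rw [← ENNReal.ofReal_toReal hf.eLpNorm_ne_top]
  refine eLpNorm_le_of_forall_abs_integral_mul_le (Lp.stronglyMeasurable _).measurable
    ((Lp.memLp _).integrable (by norm_num)) hqr ENNReal.toReal_nonneg fun φ hφ ⟨M, hM⟩ => ?_
  have hmem : ∀ e, MemLp φ e (stdGaussian (EuclideanSpace ℝ (Fin N))) := fun e =>
    MemLp.of_bound hφ.aestronglyMeasurable M (.of_forall hM)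
  obtain ⟨φ', hφ'⟩ : ∃ φ' : Lp ℝ 2 (stdGaussian (EuclideanSpace ℝ (Fin N))),
      φ' =ᵐ[stdGaussian (EuclideanSpace ℝ (Fin N))] φ := ⟨(hmem 2).toLp, (hmem 2).coeFn_toLp⟩
  have e1 : ∫ x, φ x * mehler _ θ f x ∂stdGaussian (EuclideanSpace ℝ (Fin N))
      = inner ℝ φ' (mehler _ θ f) := by
    rw [L2.inner_def]
    refine integral_congr_ae ?_
    filter_upwards [hφ'] with x hx
    rw [RCLike.inner_apply, conj_trivial, mul_comm, hx]
  rw [e1, ← eLpNorm_congr_ae hφ', mul_comm]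
  refine abs_inner_mehler_le h0 h1 hqr.symm.lt hp ?_ ((memLp_congr_ae hφ').2 (hmem _)) hf
  have hq' : 0 < q - 1 := by linarith
  have e3 : q.conjExponent - 1 = (q - 1)⁻¹ := by
    rw [Real.conjExponent]; field_simp; ring
  rw [e3, inv_mul_eq_div, le_div_iff₀ hq']
  exact hpq

/-- Hypercontractivity of the Ornstein–Uhlenbeck semigroup on `L² ∩ L^p`. -/
theorem eLpNorm_ouSemigroup_le
    (hY : MeasurePreserving Y P (stdGaussian (EuclideanSpace ℝ (Fin N))))
    (hYX : ∀ᵐ ω ∂P, ∀ i, Y ω i = X i ω) {t p q : ℝ} (ht : 0 < t) (hp : 1 < p)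
    (hq : q = Real.exp (2 * t) * (p - 1) + 1) {F : Lp ℝ 2 P}
    (hF : MemLp F (ENNReal.ofReal p) P) :
    eLpNorm (ouSemigroup P X t F) (ENNReal.ofReal q) P ≤ eLpNorm F (ENNReal.ofReal p) P := by
  have hexp1 : Real.exp (-t) < 1 := Real.exp_lt_one_iff.2 (by linarith)
  obtain ⟨θ, hθ⟩ : ∃ θ, Real.cos θ = Real.exp (-t) :=
    ⟨Real.arccos (Real.exp (-t)), Real.cos_arccos (by linarith [Real.exp_pos (-t)]) hexp1.le⟩
  have hq1 : 1 < q := by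
    rw [hq]
    have := mul_pos (Real.exp_pos (2 * t)) (sub_pos.2 hp)
    linarith
  have hpq : Real.cos θ ^ 2 * (q - 1) ≤ p - 1 := by
    rw [hθ, hq, add_sub_cancel_right, ← mul_assoc, ← Real.exp_nat_mul, ← Real.exp_add]
    simp
  have hadj := eLpNorm_adjoint_compMeasurePreserving_le hY hp hF
  rw [ouSemigroup_eq_mehler hY hYX ht hθ F]
  refine le_trans (le_of_eq ?_) ((eLpNorm_mehler_le (hθ ▸ Real.exp_pos _) (hθ ▸ hexp1) hp hq1 hpq
    ⟨Lp.aestronglyMeasurable _, hadj.trans_lt hF.eLpNorm_lt_top⟩).trans hadj)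
  rw [eLpNorm_congr_ae (coeFn_compMeasurePreservingₗᵢ hY (ae_eq_refl _))]
  exact eLpNorm_comp_measurePreserving (Lp.aestronglyMeasurable _) hY

end L2Bounds

section Extension

variable {Ω : Type*} [MeasurableSpace Ω] {P : Measure Ω}

/-- The subspace `L² ∩ L^r` of `L²`. -/
def MeasureTheory.Lp.twoInter (P : Measure Ω) (r : ℝ≥0∞) : Submodule ℝ (Lp ℝ 2 P) where
  carrier := {G | MemLp G r P}
  add_mem' {F G} hF hG := (memLp_congr_ae (Lp.coeFn_add F G)).2 (MemLp.add hF hG)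
  zero_mem' := (memLp_congr_ae (Lp.coeFn_zero ℝ 2 P)).2 MemLp.zero
  smul_mem' c F hF := (memLp_congr_ae (Lp.coeFn_smul c F)).2 (MemLp.const_smul hF c)

/-- A linear map of `L²` that maps `L² ∩ L^r` to `L^s`, as a map between these spaces. -/
noncomputable def MeasureTheory.Lp.twoInterMap {r s : ℝ≥0∞} (T : Lp ℝ 2 P →ₗ[ℝ] Lp ℝ 2 P)
    (hT : ∀ F : Lp ℝ 2 P, MemLp F r P → MemLp (T F) s P) : Lp.twoInter P r →ₗ[ℝ] Lp ℝ s P where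
  toFun G := (hT G.1 G.2).toLp
  map_add' F G := by
    rw [← MemLp.toLp_add]
    refine MemLp.toLp_congr _ _ ?_
    rw [Submodule.coe_add, map_add]
    exact Lp.coeFn_add _ _
  map_smul' c F := by
    rw [RingHom.id_apply, ← MemLp.toLp_const_smul]
    refine MemLp.toLp_congr _ _ ?_
    rw [Submodule.coe_smul, map_smul]
    exact Lp.coeFn_smul _ _

theorem MeasureTheory.Lp.coeFn_twoInterMap {r s : ℝ≥0∞} (T : Lp ℝ 2 P →ₗ[ℝ] Lp ℝ 2 P)
    (hT : ∀ F : Lp ℝ 2 P, MemLp F r P → MemLp (T F) s P) (G : Lp.twoInter P r) :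
    Lp.twoInterMap T hT G =ᵐ[P] T G :=
  MemLp.coeFn_toLp (hT G.1 G.2)

theorem MeasureTheory.Lp.denseRange_twoInterMap_id [IsFiniteMeasure P] {r : ℝ≥0∞}
    [Fact (1 ≤ r)] (hr : r ≠ ∞) :
    DenseRange (Lp.twoInterMap (P := P) (r := r) (s := r) LinearMap.id fun _ h => h) := by
  refine (Lp.simpleFunc.denseRange (E := ℝ) (μ := P) hr).mono ?_
  rintro _ ⟨g, rfl⟩
  have hg := Lp.simpleFunc.toSimpleFunc_eq_toFun g
  have h2 : MemLp (Lp.simpleFunc.toSimpleFunc g) 2 P := SimpleFunc.memLp_of_isFiniteMeasure _ _ _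
  have hgr : MemLp h2.toLp r P := (memLp_congr_ae (h2.coeFn_toLp.trans hg)).2 (Lp.memLp _)
  exact ⟨⟨h2.toLp, hgr⟩, Lp.ext ((Lp.coeFn_twoInterMap _ _ _).trans (h2.coeFn_toLp.trans hg))⟩

/-- A linear map of `L²` that contracts the `L^p` norm to the `L^q` norm, `p ≤ q`, extends
uniquely to `L^p`, with the same bound. -/
theorem exists_extension_of_eLpNorm_le [IsProbabilityMeasure P] {p q : ℝ≥0∞} [Fact (1 ≤ p)]
    (hp : p ≠ ∞) (hpq : p ≤ q) (T : Lp ℝ 2 P →ₗ[ℝ] Lp ℝ 2 P)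
    (hT : ∀ F : Lp ℝ 2 P, MemLp F p P → eLpNorm (T F) q P ≤ eLpNorm F p P) :
    ∃ S : Lp ℝ p P →L[ℝ] Lp ℝ p P,
      (∀ (F : Lp ℝ p P) (G : Lp ℝ 2 P), F =ᵐ[P] G → S F =ᵐ[P] T G) ∧
      (∀ S' : Lp ℝ p P →L[ℝ] Lp ℝ p P,
        (∀ (F : Lp ℝ p P) (G : Lp ℝ 2 P), F =ᵐ[P] G → S' F =ᵐ[P] T G) → S' = S) ∧
      ∀ F : Lp ℝ p P, MemLp (S F) q P ∧ eLpNorm (S F) q P ≤ eLpNorm F p P := by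
  have hTp : ∀ F : Lp ℝ 2 P, MemLp F p P → MemLp (T F) p P := fun F hF =>
    MemLp.mono_exponent ⟨Lp.aestronglyMeasurable _, (hT F hF).trans_lt hF.eLpNorm_lt_top⟩ hpq
  set e := Lp.twoInterMap (P := P) (r := p) (s := p) LinearMap.id fun _ h => h with he
  set f := Lp.twoInterMap T hTp with hf
  have hdense : DenseRange e := Lp.denseRange_twoInterMap_id hp
  have hec : ∀ G, e G =ᵐ[P] (G : Lp ℝ 2 P) := fun G => Lp.coeFn_twoInterMap _ _ G
  have hfc : ∀ G, f G =ᵐ[P] T G := fun G => Lp.coeFn_twoInterMap _ _ G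
  have hnorm : ∃ C : ℝ, ∀ G, ‖f G‖ ≤ C * ‖e G‖ := ⟨1, fun G => by
    rw [one_mul, Lp.norm_def, Lp.norm_def]
    refine ENNReal.toReal_mono (Lp.eLpNorm_ne_top _) ?_
    rw [eLpNorm_congr_ae (hec G), eLpNorm_congr_ae (hfc G)]
    exact (eLpNorm_le_eLpNorm_of_exponent_le hpq (Lp.aestronglyMeasurable _)).trans (hT _ G.2)⟩
  have hS : ∀ G, f.extendOfNorm e (e G) = f G := LinearMap.extendOfNorm_eq hdense hnorm
  have key : ∀ F : Lp ℝ p P, eLpNorm (f.extendOfNorm e F) q P ≤ eLpNorm F p P := by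
    intro F
    obtain ⟨u, hu, hul⟩ := mem_closure_iff_seq_limit.1 (hdense F)
    choose G hG using hu
    obtain rfl : u = fun n => e (G n) := funext fun n => (hG n).symm
    have hlim := (f.extendOfNorm e).continuous.continuousAt.tendsto.comp hul
    obtain ⟨ns, hns, hae⟩ := (tendstoInMeasure_of_tendsto_Lp hlim).exists_seq_tendsto_ae
    have hle := Lp.eLpNorm_lim_le_liminf_eLpNorm (p := q)
      (fun n => Lp.aestronglyMeasurable _) _ hae
    refine hle.trans ?_
    have hn : Filter.Tendsto (fun n => eLpNorm (e (G (ns n))) p P) Filter.atTop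
        (nhds (eLpNorm F p P)) := by
      have h := (continuous_enorm.tendsto F).comp (hul.comp hns.tendsto_atTop)
      simpa only [Function.comp_def, Lp.enorm_def] using h
    rw [← hn.liminf_eq]
    refine Filter.liminf_le_liminf (.of_forall fun n => ?_)
    simp only [Function.comp_apply, hS]
    rw [eLpNorm_congr_ae (hec _), eLpNorm_congr_ae (hfc _)]
    exact hT _ (G (ns n)).2
  have hrange : ∀ (F : Lp ℝ p P) (G : Lp ℝ 2 P), F =ᵐ[P] G → ∃ G' : Lp.twoInter P p,
      (G' : Lp ℝ 2 P) = G ∧ e G' = F := fun F G h =>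
    ⟨⟨G, (memLp_congr_ae h).1 (Lp.memLp F)⟩, rfl, Lp.ext ((hec _).trans h.symm)⟩
  refine ⟨f.extendOfNorm e, fun F G h => ?_, fun S' hS' => ?_, fun F =>
    ⟨⟨Lp.aestronglyMeasurable _, (key F).trans_lt (Lp.eLpNorm_lt_top _)⟩, key F⟩⟩
  · obtain ⟨G', rfl, rfl⟩ := hrange F G h
    rw [hS]
    exact hfc G'
  · refine DFunLike.coe_injective (hdense.equalizer S'.continuous
      (f.extendOfNorm e).continuous (funext fun G => ?_))
    rw [Function.comp_apply, Function.comp_apply, hS]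
    exact Lp.ext ((hS' _ _ (hec G)).trans (hfc G).symm)

end Extension

theorem mainTheorem3 {Ω : Type*} [MeasurableSpace Ω] (P : Measure Ω) [IsProbabilityMeasure P]
    (N : ℕ) (X : Fin N → Ω → ℝ)
    (hlaw : ∀ i, HasLaw (X i) (gaussianReal 0 1) P) (hind : iIndepFun X P)
    (p t q : ℝ) (hp : 1 < p) (ht : 0 < t) (hq : q = Real.exp (2 * t) * (p - 1) + 1)
    [Fact (1 ≤ ENNReal.ofReal p)] :
    p < q ∧
    ∃ T : Lp ℝ (ENNReal.ofReal p) P →L[ℝ] Lp ℝ (ENNReal.ofReal p) P,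
      ExtendsOU P X t T ∧
      (∀ S : Lp ℝ (ENNReal.ofReal p) P →L[ℝ] Lp ℝ (ENNReal.ofReal p) P,
        ExtendsOU P X t S → S = T) ∧
      ∀ F : Lp ℝ (ENNReal.ofReal p) P,
        MemLp (T F) (ENNReal.ofReal q) P ∧
        eLpNorm (T F) (ENNReal.ofReal q) P ≤ eLpNorm F (ENNReal.ofReal p) P := by
  have hpq : p < q := by
    have h1 : 1 < Real.exp (2 * t) := Real.one_lt_exp_iff.2 (by linarith)
    nlinarith
  refine ⟨hpq, ?_⟩
  obtain ⟨Y, hY, hYX⟩ := exists_measurePreserving_stdGaussian hlaw hind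
  let T : Lp ℝ 2 P →ₗ[ℝ] Lp ℝ 2 P :=
    { toFun := ouSemigroup P X t
      map_add' := fun F G => by
        refine (hasSum_ouSemigroup P X ht _).unique ?_
        simpa only [map_add, smul_add] using
          (hasSum_ouSemigroup P X ht F).add (hasSum_ouSemigroup P X ht G)
      map_smul' := fun c F => by
        refine (hasSum_ouSemigroup P X ht _).unique ?_
        simpa only [map_smul, smul_comm c, RingHom.id_apply] using
          (hasSum_ouSemigroup P X ht F).const_smul c }
  exact exists_extension_of_eLpNorm_le ENNReal.ofReal_ne_top (ENNReal.ofReal_le_ofReal hpq.le) T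
    fun F hF => eLpNorm_ouSemigroup_le hY hYX ht hp hq hF
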